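/- **Setting.** Let $K\ge 2$ and $\Delta_K=\{p\in\mathbb R_{\ge 0}^K:\sum_i p_i=1\}$. A bandit model assigns to each parameter $\vartheta$ in a parameter set $\mathcal S$ and each arm $i\in[K]$ a reward distribution $P_{\vartheta,i}$ on $\mathbb R$ with mean $m_i(\vartheta)$. We consider two models. 1. *Unstructured, one-parameter exponential family.* Let $\nu$ be a measure on $\mathbb R$, let $N$ be the interior of $\{\eta:\int e^{\eta y}\,d\nu(y)<\infty\}$, and for $\eta\in N$ let $P^\eta$ be the probability measure with $\nu$-density proportional to $e^{\eta y}$. Parameterize the family $\{P^\eta:\eta\in N\}$ by its means, let $\mathcal M$ be the set of these means, $\mathcal S=\mathcal M^K$, and let $P_{\vartheta,i}$ be the member with mean $\vartheta_i$. 2. *Gaussian linear.* $\mathcal S=\mathbb R^d$ and $P_{\vartheta,i}=\mathcal N(a_i^\top\vartheta,\sigma_i^2)$ with arbitrary feature vectors $a_1,\dots,a_K\in\mathbb R^d$ and variances $\sigma_i^2>0$. Fix $\theta\in\mathcal S$ with a unique best arm $I^*$, i.e. $m_j(\theta)<m_{I^*}(\theta)$ for all $j\ne I^*$. Put $\mathcal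 X=[K]\setminus\{I^*\}$, let $\Delta_{|\mathcal X|}$ be the simplex of probability vectors on $\mathcal X$, and for $p\in\mathbb R^K_{\ge0}$, $x\in\mathcal X$, $\mu\in\Delta_{|\mathcal X|}$ put $$D(p,x)=\inf\Bigl\{\sum_{i=1}^K p_i\,\mathrm{KL}(P_{\theta,i}\,\|\,P_{\vartheta,i}) : \vartheta\in\mathcal S,\ m_{I^*}(\vartheta)<m_x(\vartheta)\Bigr\},\qquad F(p,\mu)=\sum_{x\in\mathcal X}\mu_x D(p,x).$$ A pair $(p^*,\mu^*)\in\Delta_K\times\Delta_{|\mathcal X|}$ is a Nash equilibrium if $F(p,\mu^*)\le F(p^*,\mu^*)\le F(p^*,\mu)$ for all $p\in\Delta_K$, $\mu\in\Delta_{|\mathcal X|}$. Let $\mathcal D_F$ be the set of $(p,\mu)\in\Delta_K\times\Delta_{|\mathcal X|}$ at which $F(\cdot,\mu)$ is differentiable at $p$ relative to $\mathbb R_{\ge0}^K$, with gradient $\nabla_pF(p,\mu)$. The Clarke generalized gradient is $$\partial_p^\circ F(p,\mu)=\mathrm{conv}\Bigl\{\lim_{n\to\infty}\nabla_pF(p^n,\mu^n)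 : \mathcal D_F\ni(p^n,\mu^n)\to(p,\mu)\Bigr\},$$ and the linear oracles are $$\mathrm{LMO}_p(p,\mu)=\mathrm{conv}\Bigl\{q\in\Delta_K:\exists f\in\partial_p^\circ F(p,\mu),\ q\in\operatorname*{argmax}_{q'\in\Delta_K}q'^\top f\Bigr\},\qquad \mathrm{LMO}_\mu(p,\mu)=\operatorname*{argmin}_{\nu\in\Delta_{|\mathcal X|}}\nu^\top\nabla_\mu F(p,\mu).$$ A sequence $(p_n,\mu_n)_{n\ge0}$ is generated by Frank–Wolfe self-play (FWSP) if $(p_0,\mu_0)\in\Delta_K\times\Delta_{|\mathcal X|}$ and, for all $n\ge0$, $$p_{n+1}=p_n+\tfrac1{n+1}(q_n-p_n),\quad \mu_{n+1}=\mu_n+\tfrac1{n+1}(\nu_n-\mu_n)\quad\text{for some } q_n\in\mathrm{LMO}_p(p_n,\mu_n),\ \nu_n\in\mathrm{LMO}_\mu(p_n,\mu_n)$$ (in particular, one-hot choices of $q_n,\nu_n$ with arbitrary tie-breaking are allowed). **Theorem.** In both models the game has an optimal value $F^*$, that is, a Nash equilibrium exists and $F$ takes the same value $F^*$ at all Nash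 equilibria; and every sequence generated by FWSP, from any initial point in $\Delta_K\times\Delta_{|\mathcal X|}$, satisfies $$\lim_{n\to\infty}F(p_n,\mu_n)=F^*.$$ -/

import Mathlib

open MeasureTheory ProbabilityTheory Filter Topology
open scoped NNReal ENNReal Matrix

noncomputable section

namespace FWSP

/-! ### Zero-sum games on a product of simplices and Frank–Wolfe self-play

`F p μ` is the payoff; the first player maximizes over `p` in the simplex over `ι`, the second
minimizes over `μ` in the simplex over `X`. The payoff is meaningful for all `p` in the nonnegative
orthant, and gradients in `p` are taken there. -/

section Game

variable {ι X : Type*} [Fintype ι] [Fintype X]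

/-- `F (·, μ)` is differentiable at `p` relative to the nonnegative orthant `Set.Ici 0`
(at points with positive coordinates this is ordinary differentiability). -/
def DifferentiableInP (F : (ι → ℝ) → (X → ℝ) → ℝ) (p : ι → ℝ) (μ : X → ℝ) : Prop :=
  DifferentiableWithinAt ℝ (fun p' => F p' μ) (Set.Ici 0) p

open Classical in
/-- The gradient `∇_p F (p, μ)`, relative to the nonnegative orthant. -/
def gradP (F : (ι → ℝ) → (X → ℝ) → ℝ) (p : ι → ℝ) (μ : X → ℝ) : ι → ℝ :=
  fun i => fderivWithin ℝ (fun p' => F p' μ) (Set.Ici 0) p (Pi.single i 1)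

open Classical in
/-- The gradient `∇_μ F (p, μ)`. -/
def gradMu (F : (ι → ℝ) → (X → ℝ) → ℝ) (p : ι → ℝ) (μ : X → ℝ) : X → ℝ :=
  fun x => fderiv ℝ (fun μ' => F p μ') μ (Pi.single x 1)

/-- The Clarke generalized gradient of `F` in `p`: the convex hull of all limits of gradients
`∇_p F` along sequences of points of differentiability in the product of the simplices that
converge to `(p, μ)`. Where `∇_p F` exists and is continuous this is the singleton of the
classical gradient; where it merely exists, it belongs to this set. -/
def clarkeGrad (F : (ι → ℝ) → (X → ℝ) → ℝ) (p : ι → ℝ) (μ : X → ℝ) : Set (ι → ℝ) :=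
  convexHull ℝ {f | ∃ (ps : ℕ → ι → ℝ) (μs : ℕ → X → ℝ),
    (∀ n, ps n ∈ stdSimplex ℝ ι ∧ μs n ∈ stdSimplex ℝ X ∧ DifferentiableInP F (ps n) (μs n)) ∧
    Tendsto ps atTop (𝓝 p) ∧ Tendsto μs atTop (𝓝 μ) ∧
    Tendsto (fun n => gradP F (ps n) (μs n)) atTop (𝓝 f)}

/-- The linear oracle of the maximizing player. -/
def lmoP (F : (ι → ℝ) → (X → ℝ) → ℝ) (p : ι → ℝ) (μ : X → ℝ) : Set (ι → ℝ) :=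
  convexHull ℝ {q | q ∈ stdSimplex ℝ ι ∧
    ∃ f ∈ clarkeGrad F p μ, ∀ q' ∈ stdSimplex ℝ ι, q' ⬝ᵥ f ≤ q ⬝ᵥ f}

/-- The linear oracle of the minimizing player. -/
def lmoMu (F : (ι → ℝ) → (X → ℝ) → ℝ) (p : ι → ℝ) (μ : X → ℝ) : Set (X → ℝ) :=
  {ν | ν ∈ stdSimplex ℝ X ∧
    ∀ ν' ∈ stdSimplex ℝ X, ν ⬝ᵥ gradMu F p μ ≤ ν' ⬝ᵥ gradMu F p μ}

/-- `(p n, μ n)` is a trajectory of discrete-time Frank–Wolfe self-play with step sizes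
`1 / (n + 1)`, started anywhere in the product of the simplices, with arbitrary choices from
the oracles. -/
structure IsTrajectory (F : (ι → ℝ) → (X → ℝ) → ℝ) (p : ℕ → ι → ℝ) (μ : ℕ → X → ℝ) :
    Prop where
  init_p : p 0 ∈ stdSimplex ℝ ι
  init_mu : μ 0 ∈ stdSimplex ℝ X
  step_p : ∀ n : ℕ, ∃ q ∈ lmoP F (p n) (μ n),
    p (n + 1) = p n + (1 / ((n : ℝ) + 1)) • (q - p n)
  step_mu : ∀ n : ℕ, ∃ ν ∈ lmoMu F (p n) (μ n),
    μ (n + 1) = μ n + (1 / ((n : ℝ) + 1)) • (ν - μ n)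

/-- `(p, μ)` is a Nash equilibrium (saddle point) of the game. -/
def IsNash (F : (ι → ℝ) → (X → ℝ) → ℝ) (p : ι → ℝ) (μ : X → ℝ) : Prop :=
  p ∈ stdSimplex ℝ ι ∧ μ ∈ stdSimplex ℝ X ∧
    (∀ p' ∈ stdSimplex ℝ ι, F p' μ ≤ F p μ) ∧ (∀ μ' ∈ stdSimplex ℝ X, F p μ ≤ F p μ')

/-- `v` is the optimal game value: a Nash equilibrium exists, and all have payoff `v`. -/
def IsGameValue (F : (ι → ℝ) → (X → ℝ) → ℝ) (v : ℝ) : Prop :=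
  (∃ p μ, IsNash F p μ) ∧ ∀ p μ, IsNash F p μ → F p μ = v

end Game

/-! ### Best-arm identification

A bandit model assigns to every parameter `ϑ` and arm `i` the reward distribution `P ϑ i`;
`S` is the set of admissible parameters. -/

section BAI

variable {Θ ι : Type*}

/-- The mean reward of arm `i` under the parameter `ϑ`. -/
def armMean (P : Θ → ι → Measure ℝ) (ϑ : Θ) (i : ι) : ℝ := ∫ y, y ∂(P ϑ i)

/-- `I` is the unique arm with the highest mean under `θ`. -/
def IsUniqueBestArm (P : Θ → ι → Measure ℝ) (θ : Θ) (I : ι) : Prop :=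
  ∀ j, j ≠ I → armMean P θ j < armMean P θ I

/-- The scenario `x`: the parameters under which arm `x` beats arm `I`. -/
def altSet (P : Θ → ι → Measure ℝ) (S : Set Θ) (I x : ι) : Set Θ :=
  {ϑ | ϑ ∈ S ∧ armMean P ϑ I < armMean P ϑ x}

variable [Fintype ι]

/-- `Γ (p, ϑ) = ∑ i, p i * KL (P θ i ‖ P ϑ i)`. -/
def information (P : Θ → ι → Measure ℝ) (θ : Θ) (p : ι → ℝ) (ϑ : Θ) : ℝ :=
  ∑ i, p i * (InformationTheory.klDiv (P θ i) (P ϑ i)).toReal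

/-- `D (p, x)`, the infimum of `Γ (p, ϑ)` over the scenario `x`. -/
def scenarioPayoff (P : Θ → ι → Measure ℝ) (S : Set Θ) (θ : Θ) (I : ι) (p : ι → ℝ) (x : ι) : ℝ :=
  sInf (information P θ p '' altSet P S I x)

variable [DecidableEq ι]

/-- `F (p, μ) = ∑ x, μ x * D (p, x)`, the sum over all arms `x ≠ I`. -/
def payoff (P : Θ → ι → Measure ℝ) (S : Set Θ) (θ : Θ) (I : ι)
    (p : ι → ℝ) (μ : {x : ι // x ≠ I} → ℝ) : ℝ :=
  ∑ x, μ x * scenarioPayoff P S θ I p x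

end BAI

/-! ### Canonical one-parameter exponential families, parameterized by their means -/

/-- The open natural parameter space of the family with base measure `ν`. -/
def natSpace (ν : Measure ℝ) : Set ℝ := interior (integrableExpSet id ν)

/-- The member with natural parameter `η`, of density `exp (η y - A η)` with respect to `ν`. -/
def natDist (ν : Measure ℝ) (η : ℝ) : Measure ℝ := ν.tilted (fun y => η * y)

/-- The mean of the member with natural parameter `η`. -/
def natMean (ν : Measure ℝ) (η : ℝ) : ℝ := ∫ y, y ∂(natDist ν η)

/-- The mean-parameter space. -/
def meanSpace (ν : Measure ℝ) : Set ℝ := natMean ν '' natSpace ν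

/-- The member of the family with mean `m ∈ meanSpace ν` (unique: if `ν` is not concentrated at
one point then `natMean ν` is injective on `natSpace ν`, otherwise all members coincide). -/
def meanDist (ν : Measure ℝ) (m : ℝ) : Measure ℝ :=
  natDist ν (Function.invFunOn (natMean ν) (natSpace ν) m)

/-- The unstructured bandit: arm `i` has the distribution in the family with mean `ϑ i`. -/
def expModel (ν : Measure ℝ) (K : ℕ) (ϑ : Fin K → ℝ) (i : Fin K) : Measure ℝ :=
  meanDist ν (ϑ i)

/-- The admissible parameters of the unstructured bandit. -/
def expParams (ν : Measure ℝ) (K : ℕ) : Set (Fin K → ℝ) := {ϑ | ∀ i, ϑ i ∈ meanSpace ν}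

/-! ### Gaussian linear bandits -/

/-- Arm `i` has the distribution `𝒩(aᵢ ⬝ ϑ, vᵢ)`, where `aᵢ` is the `i`-th row of `A`. -/
def linModel {K d : ℕ} (A : Matrix (Fin K) (Fin d) ℝ) (v : Fin K → ℝ≥0)
    (ϑ : Fin d → ℝ) (i : Fin K) : Measure ℝ :=
  gaussianReal (A i ⬝ᵥ ϑ) (v i)

end FWSP

end

/-! On the orthant each scenario payoff `D x` is a minimum, over a compact set, of functionals
linear in `p` (`IsScenario`), hence concave and homogeneous of degree one. With step sizes 1/(n+1)
the cumulated plays P_n = n p_n and M_n = n μ_n satisfy P_{n+1} = P_n + q_n and M_{n+1} = M_n + ν_n.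
The claim becomes ∑ₓ M_n(x) D_x(P_n) / n² → v, where v is the payoff at an equilibrium; the process
is a fictitious play in which the maximizer responds to supergradients.

Continuous time (`continuous_play_value`): let D_x(t) and M_x(t) be the payoffs and weights along
the play, U = minₓ D_x, Z = ∑ M_x D_x. The minimizer adds weight only to minimizing x, so ∑ M_x' D_x
= U, ∑ M_x' D_x' = U' and m := Z' - U = ∑ M_x D_x'. Equilibrium strategies give m(s) ≥ s v and U(s)
≤ s v. The maximizer's best response gives the tangent inequality ∑ M_x(s) (D_x(t) - D_x(s)) ≤ (t -
s) m(s) for s < t. Weighted by 1 - s and integrated, it says that A(h) = ∑ ∫ (1 - s) M_x(s) D_x(s +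
h) ds lies below its tangent at 0 for h > 0, so A''(0) ≤ 0. Moving one derivative onto the weight
turns this into ∫ m ≤ ∫ (1 - s) U' = ∫ U over [0, 1]. As v/2 ≤ ∫ m and ∫ U ≤ v/2, both integrals
equal v/2, and Z(1) = ∫ m + ∫ U = v.

Discrete time (`discrete_play_value`): limits of a(⌊nt⌋)/n along an ultrafilter yield such a
continuous play, provided that the maximizer's increments miss the best-response value by o(N²) in
total, weighted by the round. The Clarke gradient before a step may differ from the slope realized
by the step. By `exists_stability`, a consequence of strict convexity, the difference is small in
coordinates of large cumulated weight, while coordinates of small weight are charged a bounded total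
(`sum_increments_below_le`).

Both models fit `IsScenario` because the open scenario can be replaced by a compact piece of its
boundary: common natural parameters of the two competing arms (`isScenario_expModel`), or a bounded
dominating piece of an affine subspace (`exists_isScenario_linModel`). -/

noncomputable section

namespace FWSP

/-! ### Cross-correlations of Lipschitz functions and the continuous-time play. -/

section Calculus

/-- A product of bounded Lipschitz functions is Lipschitz. -/
lemma lipschitzWith_mul_of_bounded {f g : ℝ → ℝ} {K L : ℝ≥0} (hf : LipschitzWith K f)
    (hg : LipschitzWith L g) (hf1 : ∀ s, |f s| ≤ 1) (hg1 : ∀ s, |g s| ≤ 1) :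
    LipschitzWith (K + L) (fun s => f s * g s) := by
  refine LipschitzWith.of_dist_le_mul fun s t => ?_
  have h1 := hf.dist_le_mul s t
  have h2 := hg.dist_le_mul s t
  rw [Real.dist_eq] at *
  have e : f s * g s - f t * g t = (f s - f t) * g s + f t * (g s - g t) := by ring
  rw [e]
  calc _ ≤ |(f s - f t) * g s| + |f t * (g s - g t)| := abs_add_le _ _
    _ = |f s - f t| * |g s| + |f t| * |g s - g t| := by rw [abs_mul, abs_mul]
    _ ≤ |f s - f t| * 1 + 1 * |g s - g t| := by
        gcongr
        · exact hg1 s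
        · exact hf1 t
    _ ≤ _ := by push_cast; rw [Real.dist_eq] at *; linarith

lemma abs_deriv_le_of_lipschitzWith {f : ℝ → ℝ} {K : ℝ≥0} (hf : LipschitzWith K f) (s : ℝ) :
    |deriv f s| ≤ K := by
  simpa using norm_deriv_le_of_lipschitz (x₀ := s) hf

lemma integrable_mul_deriv_comp_add {w D : ℝ → ℝ} {L : ℝ≥0}
    (hw : Integrable w) (hD : LipschitzWith L D) (h : ℝ) :
    Integrable (fun s => w s * deriv D (s + h)) := by
  refine hw.mul_bdd (c := L) ?_ (Eventually.of_forall fun s => ?_)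
  · exact ((measurable_deriv D).comp (measurable_add_const h)).aestronglyMeasurable
  · simpa using abs_deriv_le_of_lipschitzWith hD (s + h)

lemma integrable_mul_comp_add {w D : ℝ → ℝ} {K L : ℝ≥0} (hw : LipschitzWith K w)
    (hwc : HasCompactSupport w) (hD : LipschitzWith L D) (h : ℝ) :
    Integrable (fun s => w s * D (s + h)) :=
  (hw.continuous.mul (hD.continuous.comp (continuous_add_const h))).integrable_of_hasCompactSupport
    (hwc.mul_right)

/-- The cross-correlation of a compactly supported and a Lipschitz function is differentiable. -/
lemma hasDerivAt_integral_mul_comp_add {w D : ℝ → ℝ} {K L : ℝ≥0} (hw : LipschitzWith K w)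
    (hwc : HasCompactSupport w) (hD : LipschitzWith L D) (h : ℝ) :
    HasDerivAt (fun h => ∫ s, w s * D (s + h)) (∫ s, w s * deriv D (s + h)) h := by
  have hwi := hw.continuous.integrable_of_hasCompactSupport (μ := volume) hwc
  refine (hasDerivAt_integral_of_dominated_loc_of_lip (s := Set.univ)
    (bound := fun s => w s * L) Filter.univ_mem ?_ ?_ ?_ ?_ ?_ ?_).2
  · exact Eventually.of_forall fun h' =>
      (integrable_mul_comp_add hw hwc hD h').aestronglyMeasurable
  · exact integrable_mul_comp_add hw hwc hD h
  · exact (integrable_mul_deriv_comp_add hwi hD h).aestronglyMeasurable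
  · refine Eventually.of_forall fun s => ?_
    refine (LipschitzWith.of_dist_le_mul fun a b => ?_).lipschitzOnWith
    have := hD.dist_le_mul (s + a) (s + b)
    simp only [Real.dist_eq, Real.coe_nnabs, abs_mul, NNReal.abs_eq] at this ⊢
    rw [← mul_sub, abs_mul, mul_assoc]
    gcongr
    simpa using this
  · exact hwi.mul_const _
  · have h1 : ∀ᵐ s : ℝ, DifferentiableAt ℝ D s := hD.ae_differentiableAt_real
    have h2 : ∀ᵐ s : ℝ, DifferentiableAt ℝ D (s + h) :=
      (measurePreserving_add_right volume h).quasiMeasurePreserving.ae h1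
    filter_upwards [h2] with s hs
    exact (hs.hasDerivAt.comp_const_add s h).const_mul (w s)

/-- The second derivative of the cross-correlation at `0`. -/
lemma hasDerivAt_integral_mul_deriv_comp_add {w D : ℝ → ℝ} {K L : ℝ≥0} (hw : LipschitzWith K w)
    (hwc : HasCompactSupport w) (hD : LipschitzWith L D) :
    HasDerivAt (fun h => ∫ s, w s * deriv D (s + h)) (-∫ s, deriv w s * deriv D s) 0 := by
  have hwi := hw.continuous.integrable_of_hasCompactSupport (μ := volume) hwc
  -- `deriv D` is merely bounded, so the shift is moved onto the Lipschitz factor `w` before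
  -- differentiating in `h`.
  have e : (fun h => ∫ s, w s * deriv D (s + h)) = fun h => ∫ s, w (s - h) * deriv D s := by
    ext h
    rw [← integral_add_right_eq_self (fun s => w (s - h) * deriv D s) h]
    simp
  rw [e, ← integral_neg]
  obtain ⟨R, hR0, hR⟩ : ∃ R, 0 < R ∧ ∀ s, R ≤ |s| → w s = 0 := by
    obtain ⟨R, hR, h⟩ := hwc.exists_pos_le_norm
    exact ⟨R, hR, h⟩
  have hmeas : ∀ h : ℝ, AEStronglyMeasurable (fun s => w (s - h) * deriv D s) := fun h =>
    ((hw.continuous.comp (continuous_id.sub continuous_const)).measurable.mul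
      (measurable_deriv D)).aestronglyMeasurable
  refine (hasDerivAt_integral_of_dominated_loc_of_lip (s := Metric.ball 0 1)
    (bound := (Set.Icc (-(R + 1)) (R + 1)).indicator fun _ => (K : ℝ) * L)
    (Metric.ball_mem_nhds _ one_pos) (Eventually.of_forall hmeas) ?_ ?_ ?_ ?_ ?_).2
  · simpa using integrable_mul_deriv_comp_add hwi hD 0
  · exact (((measurable_deriv w).mul (measurable_deriv D)).neg).aestronglyMeasurable
  · refine Eventually.of_forall fun s => LipschitzOnWith.of_dist_le_mul fun a ha b hb => ?_
    rw [mem_ball_zero_iff, Real.norm_eq_abs, abs_lt] at ha hb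
    by_cases hs : s ∈ Set.Icc (-(R + 1)) (R + 1)
    · rw [Set.indicator_of_mem hs]
      have h1 := hw.dist_le_mul (s - a) (s - b)
      have h2 := abs_deriv_le_of_lipschitzWith hD s
      simp only [Real.dist_eq, Real.coe_nnabs, abs_mul, NNReal.abs_eq] at h1 ⊢
      rw [← sub_mul, abs_mul, abs_sub_comm a b]
      have e2 : s - a - (s - b) = b - a := by ring
      rw [e2] at h1
      rw [mul_right_comm]
      gcongr
    · have hz : ∀ c, -1 < c → c < 1 → w (s - c) = 0 := by
        intro c hc1 hc2
        refine hR _ ?_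
        rw [Set.mem_Icc, not_and_or, not_le, not_le] at hs
        rcases hs with hs | hs
        · rw [abs_of_neg] <;> linarith
        · rw [abs_of_pos] <;> linarith
      rw [hz a ha.1 ha.2, hz b hb.1 hb.2]
      simp only [zero_mul, dist_self]
      positivity
  · exact (integrable_indicator_iff measurableSet_Icc).2 (integrableOn_const (by simp))
  · filter_upwards [hw.ae_differentiableAt_real] with s hs
    have h1 : HasDerivAt w (deriv w s) (s - 0) := by simpa using hs.hasDerivAt
    simpa using (h1.comp_const_sub s 0).mul_const (deriv D s)

/-- A function lying below its tangent to the right of `0` has nonpositive second derivative. -/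
lemma second_deriv_nonpos_of_le_tangent {A A' : ℝ → ℝ} {a : ℝ} (hA : ∀ h, HasDerivAt A (A' h) h)
    (hA' : HasDerivAt A' a 0) (hle : ∀ h, 0 < h → A h ≤ A 0 + h * A' 0) : a ≤ 0 := by
  by_contra! ha
  have h1 : ∀ᶠ u in 𝓝[>] (0 : ℝ), 0 < slope A' 0 u :=
    ((hasDerivAt_iff_tendsto_slope.1 hA').mono_left
      (nhdsWithin_mono _ fun u hu => ne_of_gt hu)).eventually_const_lt ha
  obtain ⟨b, hb, hb'⟩ := mem_nhdsGT_iff_exists_Ioo_subset.1 h1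
  have hb0 : (0 : ℝ) < b := hb
  -- If `a > 0`, then `A'` exceeds `A' 0` just to the right of `0`, so `A` rises strictly above its
  -- tangent.
  have hmono : StrictMonoOn (fun u => A u - u * A' 0) (Set.Icc 0 (b / 2)) := by
    refine strictMonoOn_of_deriv_pos (convex_Icc _ _) ?_ ?_
    · exact fun u _ => ((hA u).continuousAt.sub
        (continuousAt_id.mul continuousAt_const)).continuousWithinAt
    · intro u hu
      rw [interior_Icc] at hu
      have h2 := hb' (show u ∈ Set.Ioo 0 b from ⟨hu.1, by linarith [hu.2]⟩)
      simp only [Set.mem_ofPred_eq, slope_def_field, sub_zero] at h2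
      have hd : HasDerivAt (fun u => A u - u * A' 0) (A' u - 1 * A' 0) u :=
        (hA u).sub ((hasDerivAt_id u).mul_const (A' 0))
      rw [hd.deriv]
      have := (div_pos_iff_of_pos_right hu.1).1 h2
      linarith
  have h3 := hmono (Set.left_mem_Icc.2 (by linarith)) (Set.right_mem_Icc.2 (by linarith))
    (by linarith : (0 : ℝ) < b / 2)
  have h4 := hle (b / 2) (by linarith)
  simp only [zero_mul, sub_zero] at h3
  linarith

/-- The value of a continuous-time play: `D x` and `M x` are the payoffs and the cumulated weights
of the minimizer, who only increases weights of minimizers of `D`, and the payoff satisfies the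
tangent inequality `hconc` of a maximizer of a concave function. -/
theorem continuous_play_value {X : Type*} [Fintype X] {D M : X → ℝ → ℝ} {U : ℝ → ℝ} {C : ℝ≥0}
    {v : ℝ} (hD : ∀ x, LipschitzWith C (D x)) (hM : ∀ x, LipschitzWith 1 (M x))
    (hU : LipschitzWith C U) (hM0 : ∀ x t, t ≤ 0 → M x t = 0) (hMpos : ∀ x t, 0 ≤ M x t)
    (hMsum : ∀ t, 0 ≤ t → ∑ x, M x t = t) (hU0 : U 0 = 0) (hUle : ∀ x t, U t ≤ D x t)
    (hcomp : ∀ x s, U s < D x s → deriv (M x) s = 0)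
    (hconc : ∀ s, 0 < s → (∀ x, DifferentiableAt ℝ (M x) s) → (∀ x, DifferentiableAt ℝ (D x) s) →
      ∀ t, s < t → ∑ x, M x s * (D x t - D x s) ≤
        (t - s) * (deriv (fun t => ∑ x, M x t * D x t) s - U s))
    (hlow : ∀ s, 0 < s → (∀ x, DifferentiableAt ℝ (M x) s) → (∀ x, DifferentiableAt ℝ (D x) s) →
      s * v ≤ deriv (fun t => ∑ x, M x t * D x t) s - U s)
    (hup : ∀ s, 0 ≤ s → U s ≤ s * v) :
    ∑ x, M x 1 * D x 1 = v := by
  have hMone : ∀ x t, t ≤ 1 → M x t ≤ 1 := by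
    intro x t ht
    rcases le_total t 0 with h | h
    · rw [hM0 x t h]; exact zero_le_one
    · have := Finset.single_le_sum (f := fun x => M x t) (fun x _ => hMpos x t) (Finset.mem_univ x)
      rw [hMsum t h] at this
      exact this.trans ht
  set m : ℝ → ℝ := fun s => ∑ x, M x s * deriv (D x) s with hm
  -- pointwise identities at points of differentiability
  have hdiff : ∀ᵐ s : ℝ, (∀ x, DifferentiableAt ℝ (M x) s) ∧ (∀ x, DifferentiableAt ℝ (D x) s) ∧
      DifferentiableAt ℝ U s := by
    have h1 : ∀ᵐ s : ℝ, ∀ x, DifferentiableAt ℝ (M x) s :=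
      ae_all_iff.2 fun x => (hM x).ae_differentiableAt_real
    have h2 : ∀ᵐ s : ℝ, ∀ x, DifferentiableAt ℝ (D x) s :=
      ae_all_iff.2 fun x => (hD x).ae_differentiableAt_real
    filter_upwards [h1, h2, hU.ae_differentiableAt_real] with s a b c using ⟨a, b, c⟩
  have hsum1 : ∀ s, 0 < s → (∀ x, DifferentiableAt ℝ (M x) s) → ∑ x, deriv (M x) s = 1 := by
    intro s hs hd
    have h1 : HasDerivAt (fun t => ∑ x, M x t) (∑ x, deriv (M x) s) s :=
      HasDerivAt.fun_sum fun x _ => (hd x).hasDerivAt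
    have h2 : HasDerivAt (fun t => ∑ x, M x t) 1 s :=
      (hasDerivAt_id s).congr_of_eventuallyEq
        ((lt_mem_nhds hs).mono fun t ht => hMsum t ht.le)
    exact h1.unique h2
  have hMD : ∀ s, 0 < s → (∀ x, DifferentiableAt ℝ (M x) s) →
      ∑ x, deriv (M x) s * D x s = U s := by
    intro s hs hd
    calc _ = ∑ x, deriv (M x) s * U s := by
          refine Finset.sum_congr rfl fun x _ => ?_
          rcases (hUle x s).eq_or_lt with h | h
          · rw [h]
          · rw [hcomp x s h]; simp
      _ = U s := by rw [← Finset.sum_mul, hsum1 s hs hd, one_mul]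
  have hMD' : ∀ s, 0 < s → (∀ x, DifferentiableAt ℝ (M x) s) →
      (∀ x, DifferentiableAt ℝ (D x) s) → DifferentiableAt ℝ U s →
      ∑ x, deriv (M x) s * deriv (D x) s = deriv U s := by
    intro s hs hd hd2 hd3
    calc _ = ∑ x, deriv (M x) s * deriv U s := by
          refine Finset.sum_congr rfl fun x _ => ?_
          rcases (hUle x s).eq_or_lt with h | h
          -- `D x - U` is nonnegative and vanishes at `s`, so its derivative vanishes there: active
          -- actions have the same slope as `U`.
          · have hmin : IsLocalMin (fun t => D x t - U t) s := by
              refine Eventually.of_forall fun t => ?_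
              have := hUle x t
              simp only [h, sub_self]
              linarith
            have h3 := hmin.hasDerivAt_eq_zero ((hd2 x).hasDerivAt.sub hd3.hasDerivAt)
            rw [sub_eq_zero.1 h3]
          · rw [hcomp x s h]; simp
      _ = deriv U s := by rw [← Finset.sum_mul, hsum1 s hs hd, one_mul]
  have hZ : ∀ s, 0 < s → (∀ x, DifferentiableAt ℝ (M x) s) → (∀ x, DifferentiableAt ℝ (D x) s) →
      deriv (fun t => ∑ x, M x t * D x t) s - U s = m s := by
    intro s hs hd hd2
    have h1 : HasDerivAt (fun t => ∑ x, M x t * D x t)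
        (∑ x, (deriv (M x) s * D x s + M x s * deriv (D x) s)) s :=
      HasDerivAt.fun_sum fun x _ => (hd x).hasDerivAt.mul (hd2 x).hasDerivAt
    rw [h1.deriv, Finset.sum_add_distrib, hMD s hs hd]
    ring
  -- the weights
  set g : ℝ → ℝ := fun s => max (1 - max s 0) 0 with hg
  have hgL : LipschitzWith 1 g := by
    have h1 : LipschitzWith 1 (fun s : ℝ => max s 0) := LipschitzWith.id.max_const 0
    have h2 : LipschitzWith 1 (fun s : ℝ => 1 - max s 0) := by
      refine LipschitzWith.of_dist_le_mul fun s t => ?_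
      rw [Real.dist_eq]
      have := h1.dist_le_mul t s
      rw [Real.dist_eq] at this
      have e : (1 - max s 0) - (1 - max t 0) = max t 0 - max s 0 := by ring
      rw [e, dist_comm s t]; exact this
    exact h2.max_const 0
  -- On `(0, 1)` this is `(1 - s) * M x s`; the truncations make it globally Lipschitz and zero
  -- elsewhere. The factor `1 - s` later turns `∫ (1 - s) U'` into `∫ U`.
  set w : X → ℝ → ℝ := fun x s => g s * M x (min s 1) with hw
  have hwL : ∀ x, LipschitzWith (1 + 1 * 1) (w x) := by
    intro x
    refine lipschitzWith_mul_of_bounded hgL ((hM x).comp (LipschitzWith.id.min_const 1)) ?_ ?_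
    · intro s
      simp only [hg]
      rw [abs_le]
      constructor
      · linarith [le_max_right (1 - max s 0) 0]
      · exact max_le (by linarith [le_max_right s 0]) zero_le_one
    · intro s
      rw [abs_of_nonneg (hMpos _ _)]
      exact hMone x _ (min_le_right _ _)
  have hw0 : ∀ x s, s ∉ Set.Ioo (0 : ℝ) 1 → w x s = 0 := by
    intro x s hs
    rw [Set.mem_Ioo, not_and_or, not_lt, not_lt] at hs
    rcases hs with hs | hs
    · simp only [hw]
      rw [hM0 x _ ((min_le_left _ _).trans hs), mul_zero]
    · simp only [hw, hg]
      rw [max_eq_right (a := 1 - max s 0) (by linarith [le_max_left s 0]), zero_mul]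
  have hw1 : ∀ x s, s ∈ Set.Ioo (0 : ℝ) 1 → w x s = (1 - s) * M x s := by
    intro x s hs
    simp only [hw, hg]
    rw [max_eq_left hs.1.le, max_eq_left (by linarith [hs.2]), min_eq_left hs.2.le]
  have hwc : ∀ x, HasCompactSupport (w x) := fun x =>
    HasCompactSupport.intro (isCompact_Icc (a := (0 : ℝ)) (b := 1)) fun s hs =>
      hw0 x s fun h => hs (Set.Ioo_subset_Icc_self h)
  have hwi : ∀ x, Integrable (w x) := fun x =>
    (hwL x).continuous.integrable_of_hasCompactSupport (hwc x)
  have hA : ∀ h, HasDerivAt (fun h => ∑ x, ∫ s, w x s * D x (s + h))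
      (∑ x, ∫ s, w x s * deriv (D x) (s + h)) h := fun h =>
    HasDerivAt.fun_sum fun x _ => hasDerivAt_integral_mul_comp_add (hwL x) (hwc x) (hD x) h
  have hA' : HasDerivAt (fun h => ∑ x, ∫ s, w x s * deriv (D x) (s + h))
      (∑ x, -∫ s, deriv (w x) s * deriv (D x) s) 0 :=
    HasDerivAt.fun_sum fun x _ => hasDerivAt_integral_mul_deriv_comp_add (hwL x) (hwc x) (hD x)
  have hle : ∀ h, 0 < h → ∑ x, ∫ s, w x s * D x (s + h) ≤
      ∑ x, (∫ s, w x s * D x (s + 0)) + h * ∑ x, ∫ s, w x s * deriv (D x) (s + 0) := by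
    intro h hh
    have i1 : ∀ x, Integrable (fun s => w x s * D x (s + h)) := fun x =>
      integrable_mul_comp_add (hwL x) (hwc x) (hD x) h
    have i2 : ∀ x, Integrable (fun s => w x s * D x (s + 0)) := fun x =>
      integrable_mul_comp_add (hwL x) (hwc x) (hD x) 0
    have i3 : ∀ x, Integrable (fun s => w x s * deriv (D x) (s + 0)) := fun x =>
      integrable_mul_deriv_comp_add (hwi x) (hD x) 0
    rw [← integral_finsetSum _ fun x _ => i1 x, ← integral_finsetSum _ fun x _ => i2 x,
      ← integral_finsetSum _ fun x _ => i3 x, ← integral_const_mul,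
      ← integral_add (integrable_finsetSum _ fun x _ => i2 x)
        ((integrable_finsetSum _ fun x _ => i3 x).const_mul h)]
    refine integral_mono_ae (integrable_finsetSum _ fun x _ => i1 x)
      ((integrable_finsetSum _ fun x _ => i2 x).add
        ((integrable_finsetSum _ fun x _ => i3 x).const_mul h)) ?_
    -- The integrated inequality is the tangent inequality `hconc` between `s` and `s + h`,
    -- multiplied by `1 - s`.
    filter_upwards [hdiff] with s hs
    simp only [add_zero]
    by_cases hs1 : s ∈ Set.Ioo (0 : ℝ) 1
    · have h1 := hconc s hs1.1 hs.1 hs.2.1 (s + h) (by linarith)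
      rw [hZ s hs1.1 hs.1 hs.2.1, add_sub_cancel_left] at h1
      have h2 := mul_le_mul_of_nonneg_left h1 (by linarith [hs1.2] : 0 ≤ 1 - s)
      simp only [hw1 _ s hs1, hm] at h2 ⊢
      simp only [mul_sub, Finset.sum_sub_distrib, Finset.mul_sum] at h2
      simp only [Finset.mul_sum]
      have e1 : ∑ x, (1 - s) * M x s * D x (s + h) = ∑ x, (1 - s) * (M x s * D x (s + h)) :=
        Finset.sum_congr rfl fun x _ => by ring
      have e2 : ∑ x, (1 - s) * M x s * D x s = ∑ x, (1 - s) * (M x s * D x s) :=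
        Finset.sum_congr rfl fun x _ => by ring
      have e3 : ∑ x, h * ((1 - s) * M x s * deriv (D x) s) =
          ∑ x, (1 - s) * (h * (M x s * deriv (D x) s)) :=
        Finset.sum_congr rfl fun x _ => by ring
      rw [e1, e2, e3]
      linarith
    · simp [hw0 _ s hs1]
  have hsecond := second_deriv_nonpos_of_le_tangent hA hA' hle
  rw [Finset.sum_neg_distrib, neg_nonpos] at hsecond
  have j1 : ∀ x, Integrable (fun s => deriv (w x) s * deriv (D x) s) := by
    intro x
    have : Integrable (deriv (w x)) := by
      refine Integrable.mono' (g := (Set.Icc (0 : ℝ) 1).indicator fun _ => ((1 + 1 * 1 : ℝ≥0) : ℝ))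
        ((integrable_indicator_iff measurableSet_Icc).2 (integrableOn_const (by simp)))
        (measurable_deriv _).aestronglyMeasurable (Eventually.of_forall fun s => ?_)
      by_cases hs : s ∈ Set.Icc (0 : ℝ) 1
      · rw [Set.indicator_of_mem hs]
        exact abs_deriv_le_of_lipschitzWith (hwL x) s
      · rw [Set.indicator_of_notMem hs]
        have : w x =ᶠ[𝓝 s] fun _ => 0 := by
          filter_upwards [isClosed_Icc.isOpen_compl.mem_nhds hs] with t ht
          exact hw0 x t fun h => ht (Set.Ioo_subset_Icc_self h)
        rw [this.deriv_eq]; simp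
    simpa using integrable_mul_deriv_comp_add this (hD x) 0
  rw [← integral_finsetSum _ fun x _ => j1 x] at hsecond
  have hUac : AbsolutelyContinuousOnInterval U 0 1 :=
    hU.lipschitzOnWith.absolutelyContinuousOnInterval
  have hlac : AbsolutelyContinuousOnInterval (fun s : ℝ => 1 - s) 0 1 := by
    refine LipschitzOnWith.absolutelyContinuousOnInterval (K := 1) ?_
    refine (LipschitzWith.of_dist_le_mul fun s t => ?_).lipschitzOnWith
    rw [Real.dist_eq, Real.dist_eq, abs_sub_comm s t]
    simp
  have hMac : ∀ x, AbsolutelyContinuousOnInterval (M x) 0 1 := fun x =>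
    (hM x).lipschitzOnWith.absolutelyContinuousOnInterval
  have hDac : ∀ x, AbsolutelyContinuousOnInterval (D x) 0 1 := fun x =>
    (hD x).lipschitzOnWith.absolutelyContinuousOnInterval
  have kM : ∀ x, IntervalIntegrable (fun s => M x s * deriv (D x) s) volume 0 1 := fun x =>
    (hDac x).intervalIntegrable_deriv.continuousOn_mul (hMac x).continuousOn
  have km : IntervalIntegrable m volume 0 1 := by
    rw [intervalIntegrable_iff]
    exact integrable_finsetSum _ fun x _ => intervalIntegrable_iff.1 (kM x)
  have kU : IntervalIntegrable U volume 0 1 := hU.continuous.intervalIntegrable _ _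
  have kU' : IntervalIntegrable (fun s => (1 - s) * deriv U s) volume 0 1 :=
    hUac.intervalIntegrable_deriv.continuousOn_mul hlac.continuousOn
  have hparts : ∫ s in (0 : ℝ)..1, (1 - s) * deriv U s = ∫ s in (0 : ℝ)..1, U s := by
    rw [hlac.integral_mul_deriv_eq_deriv_mul hUac]
    simp [hU0]
  -- The product rule gives `w' = -M + (1 - s) M'`; the two parts sum against `D'` to `-m` and `(1 -
  -- s) U'`. The kinks of `w` at the endpoints are null.
  have hinteg : ∫ s, ∑ x, deriv (w x) s * deriv (D x) s =
      ∫ s in (0 : ℝ)..1, ((1 - s) * deriv U s - m s) := by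
    rw [intervalIntegral.integral_of_le zero_le_one, integral_Ioc_eq_integral_Ioo,
      ← integral_indicator measurableSet_Ioo]
    refine integral_congr_ae ?_
    filter_upwards [hdiff, Measure.ae_ne volume (0 : ℝ), Measure.ae_ne volume (1 : ℝ)]
      with s hs hs00 hs01
    by_cases hs1 : s ∈ Set.Ioo (0 : ℝ) 1
    · rw [Set.indicator_of_mem hs1, ← hMD' s hs1.1 hs.1 hs.2.1 hs.2.2, hm, Finset.mul_sum,
        ← Finset.sum_sub_distrib]
      refine Finset.sum_congr rfl fun x _ => ?_
      have h1 : w x =ᶠ[𝓝 s] fun t => (1 - t) * M x t := by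
        filter_upwards [isOpen_Ioo.mem_nhds hs1] with t ht using hw1 x t ht
      have h2 : HasDerivAt (fun t => (1 - t) * M x t) (-1 * M x s + (1 - s) * deriv (M x) s) s :=
        ((hasDerivAt_id s).const_sub 1).mul (hs.1 x).hasDerivAt
      rw [h1.deriv_eq, h2.deriv]
      ring
    · rw [Set.indicator_of_notMem hs1]
      refine Finset.sum_eq_zero fun x _ => ?_
      have hs2 : s ∉ Set.Icc (0 : ℝ) 1 := fun h =>
        hs1 ⟨lt_of_le_of_ne h.1 (Ne.symm hs00), lt_of_le_of_ne h.2 hs01⟩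
      have : w x =ᶠ[𝓝 s] fun _ => 0 := by
        filter_upwards [isClosed_Icc.isOpen_compl.mem_nhds hs2] with t ht
        exact hw0 x t fun h => ht (Set.Ioo_subset_Icc_self h)
      rw [this.deriv_eq]; simp
  rw [hinteg, intervalIntegral.integral_sub kU' km, hparts] at hsecond
  have hZ1 : ∑ x, M x 1 * D x 1 = (∫ s in (0 : ℝ)..1, m s) + ∫ s in (0 : ℝ)..1, U s := by
    have h1 : ∀ x, M x 1 * D x 1 =
        ∫ s in (0 : ℝ)..1, deriv (M x) s * D x s + M x s * deriv (D x) s := by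
      intro x
      rw [(hMac x).integral_deriv_mul_eq_sub (hDac x), hM0 x 0 le_rfl]
      ring
    rw [Finset.sum_congr rfl fun x _ => h1 x, ← intervalIntegral.integral_finsetSum,
      ← intervalIntegral.integral_add km kU]
    · refine intervalIntegral.integral_congr_ae ?_
      filter_upwards [hdiff] with s hs hs1
      rw [Set.uIoc_of_le zero_le_one] at hs1
      rw [Finset.sum_add_distrib, hMD s hs1.1 hs.1]
      ring
    · exact fun x _ => ((hMac x).intervalIntegrable_deriv.mul_continuousOn
        (hDac x).continuousOn).add (kM x)
  have hv : ∫ s in (0 : ℝ)..1, s * v = v / 2 := by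
    rw [intervalIntegral.integral_mul_const, integral_id]; ring
  have kv : IntervalIntegrable (fun s : ℝ => s * v) volume 0 1 :=
    (continuous_id.mul continuous_const).intervalIntegrable _ _
  have b1 : v / 2 ≤ ∫ s in (0 : ℝ)..1, m s := by
    rw [← hv]
    refine intervalIntegral.integral_mono_ae_restrict zero_le_one kv km ?_
    rw [EventuallyLE, ae_restrict_iff' measurableSet_Icc]
    filter_upwards [hdiff, Measure.ae_ne volume (0 : ℝ)] with s hs hs0 hs1
    have hpos : 0 < s := lt_of_le_of_ne hs1.1 (Ne.symm hs0)
    rw [← hZ s hpos hs.1 hs.2.1]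
    exact hlow s hpos hs.1 hs.2.1
  have b2 : ∫ s in (0 : ℝ)..1, U s ≤ v / 2 := by
    rw [← hv]
    exact intervalIntegral.integral_mono_on zero_le_one kU kv fun s hs => hup s hs.1
  -- The chain `v / 2 ≤ ∫ m ≤ ∫ U ≤ v / 2` consists of equalities, and the payoff at time `1` is `∫
  -- m + ∫ U`.
  linarith

end Calculus

/-! ### Scaling limits along ultrafilters and the discrete-time play. -/

section ScalingLimit

lemma tendsto_floor_mul_div {g : Filter ℕ} (hg : g ≤ atTop) {t : ℝ} (ht : 0 ≤ t) :
    Tendsto (fun n : ℕ => (⌊(n : ℝ) * t⌋₊ : ℝ) / n) g (𝓝 t) := by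
  have := (tendsto_nat_floor_mul_div_atTop ht).comp (tendsto_natCast_atTop_atTop (R := ℝ))
  refine (this.mono_left hg).congr fun n => ?_
  simp [mul_comm]

/-- A nondecreasing sequence with bounded increments has a Lipschitz scaling limit along every
ultrafilter. -/
lemma exists_scaling_limit (g : Ultrafilter ℕ) (hg : (g : Filter ℕ) ≤ atTop) {a : ℕ → ℝ} {C : ℝ≥0}
    (ha0 : a 0 = 0) (hmono : Monotone a) (hC : ∀ r, a (r + 1) ≤ a r + C) :
    ∃ f : ℝ → ℝ, (∀ t, Tendsto (fun n : ℕ => a ⌊(n : ℝ) * t⌋₊ / n) g (𝓝 (f t))) ∧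
      LipschitzWith C f ∧ Monotone f ∧ ∀ t, t ≤ 0 → f t = 0 := by
  have hinc : ∀ r k, a (r + k) ≤ a r + C * k := by
    intro r k
    induction k with
    | zero => simp
    | succ k ih =>
      have := hC (r + k)
      rw [← add_assoc]
      push_cast
      linarith
  have hn0 : ∀ᶠ n : ℕ in g, 0 < n := hg (eventually_gt_atTop 0)
  have hex : ∀ t : ℝ, ∃ y, Tendsto (fun n : ℕ => a ⌊(n : ℝ) * t⌋₊ / n) g (𝓝 y) := by
    intro t
    have hb : ∀ᶠ n : ℕ in g, a ⌊(n : ℝ) * t⌋₊ / n ∈ Set.Icc (0 : ℝ) (C * |t|) := by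
      filter_upwards [hn0] with n hn
      have hn' : (0 : ℝ) < n := by exact_mod_cast hn
      have h1 := hinc 0 ⌊(n : ℝ) * t⌋₊
      have h2 : (⌊(n : ℝ) * t⌋₊ : ℝ) ≤ n * |t| :=
        (Nat.cast_le.2 (Nat.floor_mono (by gcongr; exact le_abs_self t))).trans
          (Nat.floor_le (by positivity))
      have h3 := hmono (Nat.zero_le ⌊(n : ℝ) * t⌋₊)
      rw [zero_add] at h1
      refine ⟨by rw [ha0] at h3; positivity, ?_⟩
      rw [div_le_iff₀ hn']
      calc _ ≤ a 0 + C * (⌊(n : ℝ) * t⌋₊ : ℝ) := h1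
        _ ≤ C * (n * |t|) := by rw [ha0, zero_add]; gcongr
        _ = _ := by ring
    obtain ⟨y, -, hy⟩ := (isCompact_Icc (a := (0 : ℝ)) (b := C * |t|)).ultrafilter_le_nhds
      (g.map fun n : ℕ => a ⌊(n : ℝ) * t⌋₊ / n) (le_principal_iff.2 hb)
    exact ⟨y, hy⟩
  choose f hf using hex
  have hfmono : Monotone f := by
    intro s t hst
    refine le_of_tendsto_of_tendsto (hf s) (hf t) ?_
    refine Eventually.of_forall fun n => ?_
    have : a ⌊(n : ℝ) * s⌋₊ ≤ a ⌊(n : ℝ) * t⌋₊ := hmono (Nat.floor_mono (by gcongr))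
    simp only
    gcongr
  refine ⟨f, hf, ?_, hfmono, ?_⟩
  · have key : ∀ s t, s ≤ t → f t ≤ f s + C * (t - s) := by
      intro s t hst
      have h1 : Tendsto (fun n : ℕ => a ⌊(n : ℝ) * s⌋₊ / n + C * (t - s) + C * (1 / (n : ℝ))) g
          (𝓝 (f s + C * (t - s) + C * 0)) :=
        ((hf s).add_const _).add
          ((tendsto_one_div_atTop_nhds_zero_nat.mono_left hg).const_mul _)
      rw [mul_zero, add_zero] at h1
      refine le_of_tendsto_of_tendsto (hf t) h1 ?_
      filter_upwards [hn0] with n hn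
      have hn' : (0 : ℝ) < n := by exact_mod_cast hn
      obtain ⟨k, hk⟩ := Nat.exists_eq_add_of_le
        (Nat.floor_mono (by gcongr : (n : ℝ) * s ≤ n * t))
      -- Rounding costs at most one round, which disappears after division by `n`.
      have h2 : (k : ℝ) ≤ n * (t - s) + 1 := by
        rcases le_total 0 s with hs | hs
        · have e := congrArg (Nat.cast (R := ℝ)) hk
          push_cast at e
          have h3 := Nat.floor_le (by have := hs.trans hst; positivity : 0 ≤ (n : ℝ) * t)
          have h4 := Nat.lt_floor_add_one ((n : ℝ) * s)
          linarith
        · have h5 : ⌊(n : ℝ) * s⌋₊ = 0 :=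
            Nat.floor_of_nonpos (mul_nonpos_of_nonneg_of_nonpos hn'.le hs)
          rw [h5, zero_add] at hk
          rw [← hk]
          rcases le_total 0 t with ht | ht
          · have := Nat.floor_le (by positivity : 0 ≤ (n : ℝ) * t)
            nlinarith
          · rw [Nat.floor_of_nonpos (mul_nonpos_of_nonneg_of_nonpos hn'.le ht)]
            have : 0 ≤ (n : ℝ) * (t - s) := mul_nonneg hn'.le (by linarith)
            push_cast
            linarith
      have h6 := hinc ⌊(n : ℝ) * s⌋₊ k
      rw [hk]
      have h7 : (C : ℝ) * k ≤ C * (n * (t - s) + 1) := by gcongr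
      rw [div_le_iff₀ hn']
      have e8 : (a ⌊(n : ℝ) * s⌋₊ / n + C * (t - s) + C * (1 / (n : ℝ))) * n =
          a ⌊(n : ℝ) * s⌋₊ + C * (n * (t - s) + 1) := by
        field_simp
        ring
      rw [e8]
      linarith
    refine LipschitzWith.of_dist_le_mul fun s t => ?_
    rw [Real.dist_eq, Real.dist_eq]
    rcases le_total s t with h | h
    · rw [abs_sub_comm, abs_sub_comm s t, abs_of_nonneg (sub_nonneg.2 (hfmono h)),
        abs_of_nonneg (sub_nonneg.2 h)]
      linarith [key s t h]
    · rw [abs_of_nonneg (sub_nonneg.2 (hfmono h)), abs_of_nonneg (sub_nonneg.2 h)]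
      linarith [key t s h]
  · intro t ht
    refine tendsto_nhds_unique (hf t) (tendsto_const_nhds.congr fun n => ?_)
    rw [Nat.floor_of_nonpos (mul_nonpos_of_nonneg_of_nonpos (Nat.cast_nonneg n) ht), ha0, zero_div]

/-- The value of a discrete-time play, by passing to the scaling limit. Here `d x r` are the
cumulated payoffs of the actions `x` of the minimizer after `r` rounds, `M x r` the cumulated
weights, and `m r` bounds the increments of the payoff. -/
theorem discrete_play_value {X : Type*} [Fintype X] {d M w : X → ℕ → ℝ} {U m : ℕ → ℝ}
    {C : ℝ≥0} {v : ℝ} (hd0 : ∀ x, d x 0 = 0) (hdmono : ∀ x, Monotone (d x))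
    (hdC : ∀ x r, d x (r + 1) ≤ d x r + C) (hM0 : ∀ x, M x 0 = 0)
    (hMstep : ∀ x r, M x (r + 1) = M x r + w x r) (hw0 : ∀ x r, 0 ≤ w x r)
    (hw1 : ∀ r, ∑ x, w x r = 1) (hUle : ∀ x r, U r ≤ d x r) (hUmem : ∀ r, ∃ x, U r = d x r)
    (hcomp : ∀ x r, U r < d x r → w x r = 0)
    (hm : ∀ s t, s ≤ t → ∑ x, M x s * (d x t - d x s) ≤ ((t : ℝ) - s) * m s)
    (herr : ∀ δ > 0, ∃ B : ℝ, ∀ N : ℕ,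
      ∑ r ∈ Finset.range N, (m r - ∑ x, M x r * (d x (r + 1) - d x r)) ≤ δ * N ^ 2 + B * N)
    (hlow : ∀ r : ℕ, r * v ≤ m r) (hup : ∀ r : ℕ, U r ≤ r * v) :
    Tendsto (fun n : ℕ => (∑ x, M x n * d x n) / (n : ℝ) ^ 2) atTop (𝓝 v) := by
  -- Along an ultrafilter every bounded rescaled quantity converges at all times `t` simultaneously,
  -- so no subsequences need to be extracted.
  rw [tendsto_iff_ultrafilter]
  intro g hg
  have hUmono : Monotone U := by
    intro r s hrs
    obtain ⟨x, hx⟩ := hUmem s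
    rw [hx]
    exact (hUle x r).trans (hdmono x hrs)
  have hUC : ∀ r, U (r + 1) ≤ U r + C := by
    intro r
    obtain ⟨x, hx⟩ := hUmem r
    rw [hx]
    exact (hUle x _).trans (hdC x r)
  have hU0 : U 0 = 0 := by
    obtain ⟨x, hx⟩ := hUmem 0
    rw [hx, hd0]
  have hMmono : ∀ x, Monotone (M x) := fun x =>
    monotone_nat_of_le_succ fun r => by rw [hMstep]; linarith [hw0 x r]
  have hMnn : ∀ x r, 0 ≤ M x r := fun x r => (hM0 x).symm.le.trans (hMmono x (Nat.zero_le r))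
  have hw1' : ∀ x r, w x r ≤ 1 := fun x r => by
    rw [← hw1 r]
    exact Finset.single_le_sum (f := fun x => w x r) (fun y _ => hw0 y r) (Finset.mem_univ x)
  have hMsum : ∀ r, ∑ x, M x r = r := by
    intro r
    induction r with
    | zero => simp [hM0]
    | succ r ih => simp only [hMstep, Finset.sum_add_distrib, ih, hw1]; push_cast; ring
  have hmnn : ∀ r, 0 ≤ m r := by
    intro r
    have h1 := hm r (r + 1) (Nat.le_succ r)
    have h2 : 0 ≤ ∑ x, M x r * (d x (r + 1) - d x r) := Finset.sum_nonneg fun x _ =>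
      mul_nonneg (hMnn x r) (sub_nonneg.2 (hdmono x (Nat.le_succ r)))
    push_cast at h1
    linarith
  have hv : 0 ≤ v := by
    have h1 := hup 1
    have h2 := hUmono (Nat.zero_le 1)
    rw [hU0] at h2
    push_cast at h1
    linarith
  choose D hDlim hDL hDmono hD0 using fun x =>
    exists_scaling_limit g hg (hd0 x) (hdmono x) (hdC x)
  choose N hNlim hNL hNmono hN0 using fun x =>
    exists_scaling_limit (C := 1) g hg (hM0 x) (hMmono x)
      (fun r => by rw [hMstep]; simpa using hw1' x r)
  obtain ⟨V, hVlim, hVL, hVmono, hV0⟩ := exists_scaling_limit g hg hU0 hUmono hUC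
  have hn0 : ∀ᶠ n : ℕ in g, 0 < n := hg (eventually_gt_atTop 0)
  have hZlim : ∀ t, Tendsto (fun n : ℕ => (∑ x, M x ⌊(n : ℝ) * t⌋₊ * d x ⌊(n : ℝ) * t⌋₊) /
      (n : ℝ) ^ 2) g (𝓝 (∑ x, N x t * D x t)) := by
    intro t
    refine (tendsto_finsetSum _ fun x _ => (hNlim x t).mul (hDlim x t)).congr fun n => ?_
    rw [Finset.sum_div]
    exact Finset.sum_congr rfl fun x _ => by rw [div_mul_div_comm, sq]
  -- sums of `m` over a window
  have hwin : ∀ δ > 0, ∃ B : ℝ, ∀ a b : ℕ, a ≤ b → ∑ r ∈ Finset.Ico a b, m r ≤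
      (∑ x, M x b * d x b) - (∑ x, M x a * d x a) - ((b : ℝ) - a) * U a + (δ * b ^ 2 + B * b) := by
    intro δ hδ
    obtain ⟨B, hB⟩ := herr δ hδ
    refine ⟨B, fun a b hab => ?_⟩
    have h1 : ∑ r ∈ Finset.Ico a b, (m r - ∑ x, M x r * (d x (r + 1) - d x r)) ≤
        δ * b ^ 2 + B * b := by
      refine le_trans (Finset.sum_le_sum_of_subset_of_nonneg ?_ ?_) (hB b)
      · intro r hr
        exact Finset.mem_range.2 (Finset.mem_Ico.1 hr).2
      -- By the tangent inequality over a single round every summand is nonnegative, so the error in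
      -- a window is at most the error up to its end.
      · intro r _ _
        have := hm r (r + 1) (Nat.le_succ r)
        push_cast at this
        linarith
    have h2 : ∑ r ∈ Finset.Ico a b, (∑ x, M x r * (d x (r + 1) - d x r) + U a) ≤
        ∑ r ∈ Finset.Ico a b, ((∑ x, M x (r + 1) * d x (r + 1)) - ∑ x, M x r * d x r) := by
      refine Finset.sum_le_sum fun r hr => ?_
      -- In the discrete product rule `h4` the new weights meet payoffs that are at least the
      -- minimum at the start of the window.
      have h3 : U a ≤ ∑ x, w x r * d x (r + 1) := by
        calc U a = ∑ x, w x r * U a := by rw [← Finset.sum_mul, hw1, one_mul]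
          _ ≤ _ := Finset.sum_le_sum fun x _ => mul_le_mul_of_nonneg_left
            ((hUle x a).trans (hdmono x (by have := (Finset.mem_Ico.1 hr).1; omega))) (hw0 x r)
      have h4 : (∑ x, M x (r + 1) * d x (r + 1)) - ∑ x, M x r * d x r =
          ∑ x, M x r * (d x (r + 1) - d x r) + ∑ x, w x r * d x (r + 1) := by
        rw [← Finset.sum_sub_distrib, ← Finset.sum_add_distrib]
        exact Finset.sum_congr rfl fun x _ => by rw [hMstep]; ring
      linarith
    rw [Finset.sum_Ico_sub (fun r => ∑ x, M x r * d x r) hab, Finset.sum_add_distrib] at h2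
    rw [Finset.sum_sub_distrib] at h1
    simp only [Finset.sum_const, Nat.card_Ico, nsmul_eq_mul, Nat.cast_sub hab] at h2
    linarith
  -- the scaling limit of the bound on a window
  have hwinlim : ∀ s t : ℝ, 0 ≤ s → s ≤ t → ∀ (c : ℝ) (cn : ℕ → ℝ), Tendsto cn g (𝓝 c) →
      (∀ᶠ n : ℕ in g, cn n * (n : ℝ) ^ 2 ≤ ∑ r ∈ Finset.Ico ⌊(n : ℝ) * s⌋₊ ⌊(n : ℝ) * t⌋₊, m r) →
      c ≤ (∑ x, N x t * D x t) - (∑ x, N x s * D x s) - (t - s) * V s := by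
    intro s t hs hst c cn hcn hle
    have hδ : ∀ δ > 0, c ≤ (∑ x, N x t * D x t) - (∑ x, N x s * D x s) - (t - s) * V s +
        δ * t ^ 2 := by
      intro δ hδ
      obtain ⟨B, hB⟩ := hwin δ hδ
      have hfs := tendsto_floor_mul_div hg hs
      have hft := tendsto_floor_mul_div hg (hs.trans hst)
      have hinv := tendsto_one_div_atTop_nhds_zero_nat (𝕜 := ℝ) |>.mono_left hg
      have hlim := ((((hZlim t).sub (hZlim s)).sub ((hft.sub hfs).mul (hVlim s))).add
        ((hft.pow 2).const_mul δ)).add ((hft.mul hinv).const_mul B)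
      rw [mul_zero, mul_zero, add_zero] at hlim
      refine le_of_tendsto_of_tendsto hcn hlim ?_
      filter_upwards [hn0, hle] with n hn hcn
      have hn' : (0 : ℝ) < n := by exact_mod_cast hn
      have h1 := hcn.trans (hB _ _ (Nat.floor_mono (by gcongr : (n : ℝ) * s ≤ n * t)))
      rw [← le_div_iff₀ (by positivity)] at h1
      refine h1.trans (le_of_eq ?_)
      field_simp
      ring
    have hlim : Tendsto (fun δ : ℝ => (∑ x, N x t * D x t) - (∑ x, N x s * D x s) -
        (t - s) * V s + δ * t ^ 2) (𝓝[>] 0) (𝓝 ((∑ x, N x t * D x t) - (∑ x, N x s * D x s) -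
        (t - s) * V s + 0 * t ^ 2)) :=
      ((tendsto_id.mono_left nhdsWithin_le_nhds).mul_const _).const_add _
    rw [zero_mul, add_zero] at hlim
    exact ge_of_tendsto hlim (eventually_mem_nhdsWithin.mono hδ)
  have hslope : ∀ s, (∀ x, DifferentiableAt ℝ (N x) s) → (∀ x, DifferentiableAt ℝ (D x) s) →
      Tendsto (fun t => ((∑ x, N x t * D x t) - (∑ x, N x s * D x s) - (t - s) * V s) / (t - s))
        (𝓝[>] s) (𝓝 (deriv (fun t => ∑ x, N x t * D x t) s - V s)) := by
    intro s h1 h2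
    have hd : DifferentiableAt ℝ (fun t => ∑ x, N x t * D x t) s :=
      DifferentiableAt.fun_sum fun x _ => (h1 x).mul (h2 x)
    have h3 := ((hasDerivAt_iff_tendsto_slope.1 hd.hasDerivAt).mono_left
      (nhdsWithin_mono s fun u (hu : s < u) => ne_of_gt hu)).sub_const (V s)
    refine h3.congr' ?_
    filter_upwards [self_mem_nhdsWithin] with t (ht : s < t)
    rw [slope_def_field]
    have : t - s ≠ 0 := by linarith
    field_simp
  have hval := continuous_play_value (D := D) (M := N) (U := V) (C := C) (v := v) hDL hNL hVL hN0
    (fun x t => by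
      rcases le_total t 0 with h | h
      · exact (hN0 x t h).symm.le
      · rw [← hN0 x 0 le_rfl]; exact hNmono x h)
    (fun t ht => by
      refine tendsto_nhds_unique (tendsto_finsetSum _ fun x _ => hNlim x t)
        ((tendsto_floor_mul_div hg ht).congr fun n => ?_)
      rw [← Finset.sum_div, hMsum])
    (hV0 0 le_rfl)
    (fun x t => le_of_tendsto_of_tendsto (hVlim t) (hDlim x t)
      (Eventually.of_forall fun n => by
        have := hUle x ⌊(n : ℝ) * t⌋₊
        simp only
        gcongr))
    ?_ ?_ ?_ ?_
  · have := hZlim 1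
    simp only [mul_one, Nat.floor_natCast] at this
    rwa [hval] at this
  · intro x s hs
    -- Strictness at `s` spreads to an interval on which even the latest minimum stays below the
    -- earliest payoff of `x`; by monotonicity `x` receives no weight in the corresponding rounds.
    obtain ⟨a, has, b, hsb, hab⟩ : ∃ a < s, ∃ b > s, V b < D x a := by
      obtain ⟨y, hy1, hy2⟩ := exists_between hs
      have h1 : ∀ᶠ a in 𝓝[<] s, y < D x a :=
        ((hDL x).continuous.tendsto s |>.mono_left nhdsWithin_le_nhds).eventually_const_lt hy2
      have h2 : ∀ᶠ b in 𝓝[>] s, V b < y :=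
        (hVL.continuous.tendsto s |>.mono_left nhdsWithin_le_nhds).eventually_lt_const hy1
      obtain ⟨a, ha, ha'⟩ := (h1.and self_mem_nhdsWithin).exists
      obtain ⟨b, hb, hb'⟩ := (h2.and self_mem_nhdsWithin).exists
      exact ⟨a, ha', b, hb', hb.trans ha⟩
    have hNab : N x b = N x a := by
      refine tendsto_nhds_unique (hNlim x b) ((hNlim x a).congr' ?_)
      filter_upwards [(hVlim b).eventually_lt (hDlim x a) hab, hn0] with n hn hn0
      have hn' : (0 : ℝ) < n := by exact_mod_cast hn0
      rw [div_lt_div_iff_of_pos_right hn'] at hn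
      have hfl : ⌊(n : ℝ) * a⌋₊ ≤ ⌊(n : ℝ) * b⌋₊ := Nat.floor_mono (by gcongr; linarith)
      have hconst : ∀ r, ⌊(n : ℝ) * a⌋₊ ≤ r → r ≤ ⌊(n : ℝ) * b⌋₊ →
          M x r = M x ⌊(n : ℝ) * a⌋₊ := by
        intro r har
        induction r, har using Nat.le_induction with
        | base => intro _; rfl
        | succ r har ih =>
          intro hrb
          rw [hMstep, ih (by omega), hcomp x r, add_zero]
          calc U r ≤ U ⌊(n : ℝ) * b⌋₊ := hUmono (by omega)
            _ < d x ⌊(n : ℝ) * a⌋₊ := hn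
            _ ≤ d x r := hdmono x har
      rw [hconst _ hfl le_rfl]
    have heq : N x =ᶠ[𝓝 s] fun _ => N x a := by
      filter_upwards [isOpen_Ioo.mem_nhds (show s ∈ Set.Ioo a b from ⟨has, hsb⟩)] with t ht
      exact le_antisymm ((hNmono x ht.2.le).trans hNab.le) (hNmono x ht.1.le)
    rw [heq.deriv_eq, deriv_const]
  · intro s hs h1 h2 t hst
    have hlim1 : Tendsto (fun b => ∑ x, N x s * (D x t - D x b)) (𝓝[>] s)
        (𝓝 (∑ x, N x s * (D x t - D x s))) :=
      tendsto_finsetSum _ fun x _ => (((hDL x).continuous.tendsto s).mono_left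
        nhdsWithin_le_nhds |>.const_sub _).const_mul _
    refine le_of_tendsto_of_tendsto hlim1 ((hslope s h1 h2).const_mul (t - s)) ?_
    filter_upwards [Ioo_mem_nhdsGT hst] with b hb
    have hbs : 0 < b - s := by linarith [hb.1]
    have hts : 0 < t - s := by linarith
    -- The discrete tangent inequality towards `t` bounds each `m r` with `r` in the window from `s`
    -- to `b` below. The window bound compares their sum with the increment of the payoff, and `b ↓
    -- s` produces its derivative.
    have key := hwinlim s b hs.le hb.1.le
      ((b - s) * (∑ x, N x s * (D x t - D x b)) / (t - s))
      (fun n : ℕ => ((⌊(n : ℝ) * b⌋₊ : ℝ) / n - (⌊(n : ℝ) * s⌋₊ : ℝ) / n) *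
        (∑ x, M x ⌊(n : ℝ) * s⌋₊ / n * (d x ⌊(n : ℝ) * t⌋₊ / n - d x ⌊(n : ℝ) * b⌋₊ / n)) /
          ((⌊(n : ℝ) * t⌋₊ : ℝ) / n - (⌊(n : ℝ) * s⌋₊ : ℝ) / n))
      ?_ ?_
    · rw [div_le_iff₀ hts] at key
      rw [← mul_div_assoc, le_div_iff₀ hbs]
      linarith
    · have fs := tendsto_floor_mul_div hg hs.le
      have fb := tendsto_floor_mul_div hg (hs.le.trans hb.1.le)
      have ft := tendsto_floor_mul_div hg (hs.le.trans hst.le)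
      exact ((fb.sub fs).mul (tendsto_finsetSum _ fun x _ =>
        (hNlim x s).mul ((hDlim x t).sub (hDlim x b)))).div (ft.sub fs) hts.ne'
    · have fs := tendsto_floor_mul_div hg hs.le
      have ft := tendsto_floor_mul_div hg (hs.le.trans hst.le)
      filter_upwards [hn0, fs.eventually_lt ft hst] with n hn hlt
      have hn' : (0 : ℝ) < n := by exact_mod_cast hn
      have hpos : 0 < (⌊(n : ℝ) * t⌋₊ : ℝ) - (⌊(n : ℝ) * s⌋₊ : ℝ) := by
        rw [div_lt_div_iff_of_pos_right hn'] at hlt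
        linarith
      have hab : ⌊(n : ℝ) * s⌋₊ ≤ ⌊(n : ℝ) * b⌋₊ := Nat.floor_mono (by gcongr; exact hb.1.le)
      have hbc : ⌊(n : ℝ) * b⌋₊ ≤ ⌊(n : ℝ) * t⌋₊ := Nat.floor_mono (by gcongr; exact hb.2.le)
      set a' := ⌊(n : ℝ) * s⌋₊
      set b' := ⌊(n : ℝ) * b⌋₊
      set c' := ⌊(n : ℝ) * t⌋₊
      have h3 : ∑ r ∈ Finset.Ico a' b', ∑ x, M x a' * (d x c' - d x b') ≤
          ∑ r ∈ Finset.Ico a' b', ((c' : ℝ) - a') * m r := by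
        refine Finset.sum_le_sum fun r hr => ?_
        obtain ⟨hr1, hr2⟩ := Finset.mem_Ico.1 hr
        calc _ ≤ ∑ x, M x r * (d x c' - d x r) := Finset.sum_le_sum fun x _ =>
              mul_le_mul (hMmono x hr1) (by linarith [hdmono x hr2.le])
                (sub_nonneg.2 (hdmono x hbc)) (hMnn x r)
          _ ≤ ((c' : ℝ) - r) * m r := hm r c' (by omega)
          _ ≤ _ := mul_le_mul_of_nonneg_right
            (by have : (a' : ℝ) ≤ r := by exact_mod_cast hr1
                linarith) (hmnn r)
      rw [Finset.sum_const, ← Finset.mul_sum, Nat.card_Ico, nsmul_eq_mul, Nat.cast_sub hab] at h3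
      have e1 : ∑ x, M x a' / n * (d x c' / n - d x b' / n) =
          (∑ x, M x a' * (d x c' - d x b')) / (n : ℝ) ^ 2 := by
        rw [Finset.sum_div]
        exact Finset.sum_congr rfl fun x _ => by field_simp
      rw [e1]
      have hne : (c' : ℝ) - a' ≠ 0 := hpos.ne'
      have e2 : ((b' : ℝ) / n - (a' : ℝ) / n) *
          ((∑ x, M x a' * (d x c' - d x b')) / (n : ℝ) ^ 2) / ((c' : ℝ) / n - (a' : ℝ) / n) *
          (n : ℝ) ^ 2 =
          ((b' : ℝ) - a') * (∑ x, M x a' * (d x c' - d x b')) / ((c' : ℝ) - a') := by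
        rw [← sub_div, ← sub_div]
        field_simp
      rw [e2, div_le_iff₀ hpos]
      linarith
  · intro s hs h1 h2
    refine ge_of_tendsto (hslope s h1 h2) ?_
    filter_upwards [self_mem_nhdsWithin] with b (hb : s < b)
    rw [le_div_iff₀ (by linarith)]
    have fs := tendsto_floor_mul_div hg hs.le
    have fb := tendsto_floor_mul_div hg (hs.le.trans hb.le)
    refine hwinlim s b hs.le hb.le _ (fun n : ℕ => (⌊(n : ℝ) * s⌋₊ : ℝ) / n * v *
      ((⌊(n : ℝ) * b⌋₊ : ℝ) / n - (⌊(n : ℝ) * s⌋₊ : ℝ) / n))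
      ((fs.mul_const v).mul (fb.sub fs)) ?_
    filter_upwards [hn0] with n hn
    have hn' : (0 : ℝ) < n := by exact_mod_cast hn
    have hab : ⌊(n : ℝ) * s⌋₊ ≤ ⌊(n : ℝ) * b⌋₊ := Nat.floor_mono (by gcongr)
    have h3 : ∑ r ∈ Finset.Ico ⌊(n : ℝ) * s⌋₊ ⌊(n : ℝ) * b⌋₊, (⌊(n : ℝ) * s⌋₊ : ℝ) * v ≤
        ∑ r ∈ Finset.Ico ⌊(n : ℝ) * s⌋₊ ⌊(n : ℝ) * b⌋₊, m r := by
      refine Finset.sum_le_sum fun r hr => le_trans ?_ (hlow r)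
      have : (⌊(n : ℝ) * s⌋₊ : ℝ) ≤ r := by exact_mod_cast (Finset.mem_Ico.1 hr).1
      gcongr
    rw [Finset.sum_const, Nat.card_Ico, nsmul_eq_mul, Nat.cast_sub hab] at h3
    refine le_trans (le_of_eq ?_) h3
    field_simp
  · intro s hs
    refine le_of_tendsto_of_tendsto (hVlim s) ((tendsto_floor_mul_div hg hs).mul_const v) ?_
    refine Eventually.of_forall fun n => ?_
    simp only
    rw [div_mul_eq_mul_div]
    have := hup ⌊(n : ℝ) * s⌋₊
    gcongr

end ScalingLimit

/-! ### Payoffs that are minima of linear functionals over a compact convex-like set. -/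

section Scenario

variable {E ι : Type*} [NormedAddCommGroup E] [NormedSpace ℝ E] [Fintype ι]

/-- `D` is, on the nonnegative orthant, the minimum of `∑ i, p i * φ i u` over a compact set of
`u` closed under midpoints, where the `φ i` are convex, and strictly convex between points at which
they differ. -/
structure IsScenario (U : Set E) (φ : ι → E → ℝ) (D : (ι → ℝ) → ℝ) : Prop where
  compact : IsCompact U
  nonempty : U.Nonempty
  cont : ∀ i, ContinuousOn (φ i) U
  nonneg : ∀ i, ∀ u ∈ U, 0 ≤ φ i u
  mid_mem : ∀ u ∈ U, ∀ u' ∈ U, (1 / 2 : ℝ) • (u + u') ∈ U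
  mid_le : ∀ i, ∀ u ∈ U, ∀ u' ∈ U, φ i ((1 / 2 : ℝ) • (u + u')) ≤ (φ i u + φ i u') / 2
  mid_lt : ∀ i, ∀ u ∈ U, ∀ u' ∈ U, φ i u ≠ φ i u' →
    φ i ((1 / 2 : ℝ) • (u + u')) < (φ i u + φ i u') / 2
  eq_sInf : ∀ p, 0 ≤ p → D p = sInf ((fun u => ∑ i, p i * φ i u) '' U)

namespace IsScenario

variable {U : Set E} {φ : ι → E → ℝ} {D : (ι → ℝ) → ℝ}

lemma exists_min (h : IsScenario U φ D) {p : ι → ℝ} (hp : 0 ≤ p) :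
    ∃ u ∈ U, D p = ∑ i, p i * φ i u ∧ ∀ u' ∈ U, D p ≤ ∑ i, p i * φ i u' := by
  have hc : ContinuousOn (fun u => ∑ i, p i * φ i u) U :=
    continuousOn_finsetSum _ fun i _ => continuousOn_const.mul (h.cont i)
  obtain ⟨u, hu, hmin⟩ := h.compact.exists_isMinOn h.nonempty hc
  have hle : IsLeast ((fun u => ∑ i, p i * φ i u) '' U) (∑ i, p i * φ i u) :=
    ⟨⟨u, hu, rfl⟩, by rintro _ ⟨u', hu', rfl⟩; exact hmin hu'⟩
  have e : D p = ∑ i, p i * φ i u := by rw [h.eq_sInf p hp, hle.csInf_eq]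
  exact ⟨u, hu, e, fun u' hu' => e.le.trans (hmin hu')⟩

lemma exists_bound (h : IsScenario U φ D) : ∃ C : ℝ≥0, ∀ i, ∀ u ∈ U, φ i u ≤ C := by
  have : ∀ i, ∃ C : ℝ, ∀ u ∈ U, φ i u ≤ C := fun i => by
    obtain ⟨C, hC⟩ := h.compact.bddAbove_image (h.cont i)
    exact ⟨C, fun u hu => hC ⟨u, hu, rfl⟩⟩
  choose C hC using this
  refine ⟨∑ i, (C i).toNNReal, fun i u hu => ((hC i u hu).trans (Real.le_coe_toNNReal _)).trans ?_⟩
  exact_mod_cast Finset.single_le_sum (f := fun i => (C i).toNNReal) (fun _ _ => zero_le)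
    (Finset.mem_univ i)

lemma payoff_nonneg (h : IsScenario U φ D) {p : ι → ℝ} (hp : 0 ≤ p) : 0 ≤ D p := by
  obtain ⟨u, hu, e, -⟩ := h.exists_min hp
  rw [e]
  exact Finset.sum_nonneg fun i _ => mul_nonneg (hp i) (h.nonneg i u hu)

lemma smul_eq (h : IsScenario U φ D) {p : ι → ℝ} (hp : 0 ≤ p) {c : ℝ} (hc : 0 ≤ c) :
    D (c • p) = c * D p := by
  have hcp : 0 ≤ c • p := smul_nonneg hc hp
  obtain ⟨u, hu, e, hmin⟩ := h.exists_min hp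
  obtain ⟨u', hu', e', hmin'⟩ := h.exists_min hcp
  have key : ∀ u, ∑ i, (c • p) i * φ i u = c * ∑ i, p i * φ i u := fun u => by
    rw [Finset.mul_sum]
    exact Finset.sum_congr rfl fun i _ => by simp [mul_assoc]
  refine le_antisymm ?_ ?_
  · rw [e, ← key]; exact hmin' u hu
  · rw [e', key]; exact mul_le_mul_of_nonneg_left (hmin u' hu') hc

lemma map_zero (h : IsScenario U φ D) : D 0 = 0 := by
  simpa using h.smul_eq (p := 0) le_rfl (c := 0) le_rfl

/-- A minimum of a sum is at least the sum of the minima. Together with `smul_eq` this is concavity.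
-/
lemma add_le (h : IsScenario U φ D) {p q : ι → ℝ} (hp : 0 ≤ p) (hq : 0 ≤ q) :
    D p + D q ≤ D (p + q) := by
  obtain ⟨u, hu, e, -⟩ := h.exists_min (add_nonneg hp hq)
  obtain ⟨-, -, -, h1⟩ := h.exists_min hp
  obtain ⟨-, -, -, h2⟩ := h.exists_min hq
  rw [e]
  simp only [Pi.add_apply, add_mul, Finset.sum_add_distrib]
  exact add_le_add (h1 u hu) (h2 u hu)

lemma mono (h : IsScenario U φ D) {p q : ι → ℝ} (hp : 0 ≤ p) (hpq : p ≤ q) : D p ≤ D q := by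
  have h1 := h.add_le hp (sub_nonneg.2 hpq)
  have h2 := h.payoff_nonneg (sub_nonneg.2 hpq)
  rw [add_sub_cancel] at h1
  linarith

lemma le_add_sum_abs (h : IsScenario U φ D) {C : ℝ≥0} (hC : ∀ i, ∀ u ∈ U, φ i u ≤ C)
    {p q : ι → ℝ} (hp : 0 ≤ p) (hq : 0 ≤ q) : D q ≤ D p + C * ∑ i, |q i - p i| := by
  obtain ⟨u, hu, e, -⟩ := h.exists_min hp
  obtain ⟨-, -, -, h2⟩ := h.exists_min hq
  refine (h2 u hu).trans ?_
  rw [e, Finset.mul_sum, ← Finset.sum_add_distrib]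
  refine Finset.sum_le_sum fun i _ => ?_
  have h3 : (q i - p i) * φ i u ≤ |q i - p i| * C :=
    mul_le_mul (le_abs_self _) (hC i u hu) (h.nonneg i u hu) (abs_nonneg _)
  linarith

lemma continuousOn (h : IsScenario U φ D) : ContinuousOn D (Set.Ici 0) := by
  obtain ⟨C, hC⟩ := h.exists_bound
  intro p hp
  have hlim : Tendsto (fun q : ι → ℝ => (C : ℝ) * ∑ i, |q i - p i|) (𝓝[Set.Ici 0] p) (𝓝 0) := by
    have : Continuous fun q : ι → ℝ => (C : ℝ) * ∑ i, |q i - p i| := by fun_prop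
    have h2 := (this.tendsto p).mono_left (nhdsWithin_le_nhds (s := Set.Ici 0))
    simpa using h2
  refine tendsto_iff_dist_tendsto_zero.2 (squeeze_zero' (Eventually.of_forall fun _ => dist_nonneg)
    ?_ hlim)
  filter_upwards [self_mem_nhdsWithin] with q hq
  rw [Real.dist_eq, abs_le]
  have h1 := h.le_add_sum_abs hC hp hq
  have h2 := h.le_add_sum_abs hC hq hp
  simp only [abs_sub_comm (p _)] at h2
  constructor <;> linarith

/-- Stability of the minimizers: adding a bounded amount of weight hardly changes `φ i` at a
minimizer if the weight of `i` is large. -/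
lemma exists_stability (h : IsScenario U φ D) {δ : ℝ} (hδ : 0 < δ) :
    ∃ L : ℝ, ∀ (i : ι) (p q : ι → ℝ) (u u' : E), 0 ≤ p → 0 ≤ q → ∑ j, q j ≤ 2 → L ≤ p i →
      u ∈ U → u' ∈ U → D p = ∑ j, p j * φ j u → D (p + q) = ∑ j, (p + q) j * φ j u' →
      φ i u ≤ φ i u' + δ := by
  obtain ⟨C, hC⟩ := h.exists_bound
  -- Compactness upgrades strict midpoint convexity to a uniform gap over all pairs whose values
  -- differ by at least `δ`.
  have hκ : ∀ i, ∃ κ > 0, ∀ u ∈ U, ∀ u' ∈ U, φ i u' + δ ≤ φ i u →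
      φ i ((1 / 2 : ℝ) • (u + u')) + κ ≤ (φ i u + φ i u') / 2 := by
    intro i
    set K : Set (E × E) := (U ×ˢ U) ∩ (fun z => φ i z.1 - φ i z.2) ⁻¹' Set.Ici δ with hK
    have c1 : ContinuousOn (fun z : E × E => φ i z.1) (U ×ˢ U) :=
      (h.cont i).comp continuousOn_fst fun z hz => hz.1
    have c2 : ContinuousOn (fun z : E × E => φ i z.2) (U ×ˢ U) :=
      (h.cont i).comp continuousOn_snd fun z hz => hz.2
    have c3 : ContinuousOn (fun z : E × E => φ i ((1 / 2 : ℝ) • (z.1 + z.2))) (U ×ˢ U) :=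
      (h.cont i).comp (by fun_prop) fun z hz => h.mid_mem _ hz.1 _ hz.2
    have hKc : IsCompact K := by
      refine (h.compact.prod h.compact).of_isClosed_subset ?_ Set.inter_subset_left
      exact (c1.sub c2).preimage_isClosed_of_isClosed
        (h.compact.prod h.compact).isClosed isClosed_Ici
    rcases K.eq_empty_or_nonempty with hKe | hKn
    · refine ⟨1, one_pos, fun u hu u' hu' hle => ?_⟩
      have : (u, u') ∈ K := ⟨⟨hu, hu'⟩, by simp only [Set.mem_preimage, Set.mem_Ici]; linarith⟩
      rw [hKe] at this
      exact absurd this (Set.notMem_empty _)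
    · obtain ⟨z, hz, hmin⟩ := hKc.exists_isMinOn hKn
        (((((c1.add c2).div_const 2).sub c3)).mono Set.inter_subset_left)
      have hzδ : δ ≤ φ i z.1 - φ i z.2 := hz.2
      refine ⟨(φ i z.1 + φ i z.2) / 2 - φ i ((1 / 2 : ℝ) • (z.1 + z.2)), ?_, ?_⟩
      · have := h.mid_lt i z.1 hz.1.1 z.2 hz.1.2 (by intro e; linarith)
        linarith
      · intro u hu u' hu' hle
        have hmem : (u, u') ∈ K :=
          ⟨⟨hu, hu'⟩, by simp only [Set.mem_preimage, Set.mem_Ici]; linarith⟩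
        have h2 : (φ i z.1 + φ i z.2) / 2 - φ i ((1 / 2 : ℝ) • (z.1 + z.2)) ≤
          (φ i u + φ i u') / 2 - φ i ((1 / 2 : ℝ) • (u + u')) := hmin hmem
        linarith
  choose κ hκ0 hκ1 using hκ
  -- If the values differed by more than `δ`, testing `p` at the midpoint and `p + q` at `u` would
  -- give `p i * κ i ≤ C`. The sum dominates every single threshold `(C + 1) / κ i`.
  refine ⟨∑ i, (C + 1) / κ i, fun i p q u u' hp hq hq2 hL hu hu' eu eu' => ?_⟩
  by_contra! hlt
  have hLi : (C + 1) / κ i ≤ p i :=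
    (Finset.single_le_sum (f := fun i => ((C : ℝ) + 1) / κ i)
      (fun j _ => div_nonneg (by positivity) (hκ0 j).le) (Finset.mem_univ i)).trans hL
  rw [div_le_iff₀ (hκ0 i)] at hLi
  obtain ⟨-, -, -, hmin⟩ := h.exists_min hp
  obtain ⟨-, -, -, hmin'⟩ := h.exists_min (add_nonneg hp hq)
  have h1 := hmin _ (h.mid_mem u hu u' hu')
  have h2 : ∑ j, p j * φ j ((1 / 2 : ℝ) • (u + u')) + p i * κ i ≤
      ∑ j, p j * ((φ j u + φ j u') / 2) := by
    classical
    rw [← Finset.add_sum_erase _ _ (Finset.mem_univ i),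
      ← Finset.add_sum_erase (f := fun j => p j * ((φ j u + φ j u') / 2)) _ (Finset.mem_univ i)]
    have a1 := mul_le_mul_of_nonneg_left (hκ1 i u hu u' hu' hlt.le) (hp i)
    have a2 : ∑ j ∈ Finset.univ.erase i, p j * φ j ((1 / 2 : ℝ) • (u + u')) ≤
        ∑ j ∈ Finset.univ.erase i, p j * ((φ j u + φ j u') / 2) :=
      Finset.sum_le_sum fun j _ => mul_le_mul_of_nonneg_left (h.mid_le j u hu u' hu') (hp j)
    linarith
  have h3 : ∑ j, p j * ((φ j u + φ j u') / 2) =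
      (∑ j, p j * φ j u + ∑ j, p j * φ j u') / 2 := by
    rw [← Finset.sum_add_distrib, Finset.sum_div]
    exact Finset.sum_congr rfl fun j _ => by ring
  have h4 := hmin' u hu
  rw [eu'] at h4
  simp only [Pi.add_apply, add_mul, Finset.sum_add_distrib] at h4
  have h5 : ∑ j, q j * φ j u ≤ ∑ j, q j * C :=
    Finset.sum_le_sum fun j _ => mul_le_mul_of_nonneg_left (hC j u hu) (hq j)
  rw [← Finset.sum_mul] at h5
  have h6 : 0 ≤ ∑ j, q j * φ j u' :=
    Finset.sum_nonneg fun j _ => mul_nonneg (hq j) (h.nonneg j u' hu')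
  have h7 : (∑ j, q j) * (C : ℝ) ≤ 2 * C := by gcongr
  linarith

end IsScenario

end Scenario

/-! ### Gradients and Clarke supergradients of the payoff. -/

section Gradients

/-- Linearity in `μ` makes the minimizer's oracle a choice among the scenarios of least payoff. -/
lemma gradMu_linear {ι X : Type*} [Fintype X] (D : X → (ι → ℝ) → ℝ) (p : ι → ℝ) (μ : X → ℝ) (x : X) :
    gradMu (fun p μ => ∑ x, μ x * D x p) p μ x = D x p := by
  classical
  have h : HasFDerivAt (fun μ' : X → ℝ => ∑ x, μ' x * D x p)
      (∑ x, D x p • ContinuousLinearMap.proj (R := ℝ) (φ := fun _ : X => ℝ) x) μ := by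
    have h2 := (∑ x, D x p • ContinuousLinearMap.proj (R := ℝ) (φ := fun _ : X => ℝ) x).hasFDerivAt
      (x := μ)
    convert h2 using 1
    ext μ'
    simp [mul_comm]
  unfold gradMu
  rw [h.fderiv]
  simp [Pi.single_apply]

variable {ι X : Type*} [Fintype ι]

/-- The derivative relative to the orthant is the limit of difference quotients along feasible
directions. -/
lemma tendsto_quotient_gradP {F : (ι → ℝ) → (X → ℝ) → ℝ} {p v : ι → ℝ} {μ : X → ℝ}
    (hd : DifferentiableInP F p μ) (hp : 0 ≤ p) (hv : 0 ≤ p + v) :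
    Tendsto (fun t : ℝ => (F (p + t • v) μ - F p μ) / t) (𝓝[>] 0) (𝓝 (v ⬝ᵥ gradP F p μ)) := by
  classical
  have e : fderivWithin ℝ (fun p' => F p' μ) (Set.Ici 0) p v = v ⬝ᵥ gradP F p μ := by
    conv_lhs => rw [pi_eq_sum_univ' v]
    simp only [map_sum, map_smul, smul_eq_mul, dotProduct, gradP]
  have hline : HasDerivWithinAt (fun t : ℝ => p + t • v) v (Set.Icc 0 1) 0 := by
    simpa using (((hasDerivAt_id (0 : ℝ)).smul_const v).const_add p).hasDerivWithinAt
  have hmaps : Set.MapsTo (fun t : ℝ => p + t • v) (Set.Icc 0 1) (Set.Ici 0) := by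
    intro t ht
    have : p + t • v = (1 - t) • p + t • (p + v) := by module
    simp only [Set.mem_Ici]
    rw [this]
    exact add_nonneg (smul_nonneg (by linarith [ht.2]) hp) (smul_nonneg ht.1 hv)
  have h1 : HasFDerivWithinAt (fun p' => F p' μ)
      (fderivWithin ℝ (fun p' => F p' μ) (Set.Ici 0) p) (Set.Ici 0) (p + (0 : ℝ) • v) := by
    simpa using DifferentiableWithinAt.hasFDerivWithinAt hd
  have h2 := h1.comp_hasDerivWithinAt (0 : ℝ) hline hmaps
  rw [e, hasDerivWithinAt_iff_tendsto_slope] at h2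
  have h3 : 𝓝[>] (0 : ℝ) ≤ 𝓝[Set.Icc 0 1 \ {0}] 0 := by
    rw [← nhdsWithin_Ioc_eq_nhdsGT (zero_lt_one' ℝ)]
    exact nhdsWithin_mono _ fun t ht => ⟨⟨ht.1.le, ht.2⟩, ht.1.ne'⟩
  refine (h2.mono_left h3).congr fun t => ?_
  simp [slope_def_field]

end Gradients

section Game

variable {E ι X : Type*} [NormedAddCommGroup E] [NormedSpace ℝ E] [Fintype ι] [Fintype X]
  {U : X → Set E} {φ : X → ι → E → ℝ} {D : X → (ι → ℝ) → ℝ}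

/-- Elements of the Clarke gradient are bounded supergradients of the homogeneous payoff. -/
lemma clarkeGrad_supergradient (h : ∀ x, IsScenario (U x) (φ x) (D x)) {C : ℝ≥0}
    (hC : ∀ x i, ∀ u ∈ U x, φ x i u ≤ C) {p : ι → ℝ} {μ : X → ℝ} (hp : 0 ≤ p)
    {f : ι → ℝ} (hf : f ∈ clarkeGrad (fun p μ => ∑ x, μ x * D x p) p μ) :
    (∀ p', 0 ≤ p' → ∑ x, μ x * D x p' ≤ p' ⬝ᵥ f) ∧ ∑ x, μ x * D x p = p ⬝ᵥ f ∧ ∀ i, f i ≤ C := by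
  classical
  set F : (ι → ℝ) → (X → ℝ) → ℝ := fun p μ => ∑ x, μ x * D x p with hF
  suffices hsub : clarkeGrad F p μ ⊆ {f | (∀ p', 0 ≤ p' → F p' μ ≤ p' ⬝ᵥ f) ∧
      F p μ = p ⬝ᵥ f ∧ ∀ i, f i ≤ C} from hsub hf
  -- At points of differentiability the three properties follow from concavity, homogeneity and the
  -- Lipschitz bound. They survive limits and convex combinations, hence hold on the whole Clarke
  -- gradient.
  have hpt : ∀ (p : ι → ℝ) (μ : X → ℝ), p ∈ stdSimplex ℝ ι → μ ∈ stdSimplex ℝ X →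
      DifferentiableInP F p μ → (∀ p', 0 ≤ p' → F p' μ ≤ p' ⬝ᵥ gradP F p μ) ∧
      F p μ = p ⬝ᵥ gradP F p μ ∧ ∀ i, gradP F p μ i ≤ C := by
    intro p μ hp hμ hd
    have hp0 : 0 ≤ p := fun i => hp.1 i
    have hsup : ∀ p', 0 ≤ p' → F p' μ - F p μ ≤ (p' - p) ⬝ᵥ gradP F p μ := by
      intro p' hp'
      refine ge_of_tendsto (tendsto_quotient_gradP hd hp0 (v := p' - p) (by simpa using hp')) ?_
      filter_upwards [Ioc_mem_nhdsGT (zero_lt_one' ℝ)] with t ht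
      rw [le_div_iff₀ ht.1]
      have e : p + t • (p' - p) = (1 - t) • p + t • p' := by module
      rw [e]
      have hx : ∀ x, (1 - t) * D x p + t * D x p' ≤ D x ((1 - t) • p + t • p') := fun x => by
        have ht1 : 0 ≤ 1 - t := by linarith [ht.2]
        have := (h x).add_le (smul_nonneg ht1 hp0) (smul_nonneg ht.1.le hp')
        rwa [(h x).smul_eq hp0 ht1, (h x).smul_eq hp' ht.1.le] at this
      have := Finset.sum_le_sum fun x (_ : x ∈ Finset.univ) =>
        mul_le_mul_of_nonneg_left (hx x) (hμ.1 x)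
      simp only [mul_add, Finset.sum_add_distrib] at this
      simp only [hF]
      have e1 : ∑ x, μ x * ((1 - t) * D x p) = (1 - t) * ∑ x, μ x * D x p := by
        rw [Finset.mul_sum]; exact Finset.sum_congr rfl fun x _ => by ring
      have e2 : ∑ x, μ x * (t * D x p') = t * ∑ x, μ x * D x p' := by
        rw [Finset.mul_sum]; exact Finset.sum_congr rfl fun x _ => by ring
      rw [e1, e2] at this
      linarith
    -- Euler's identity, from the supergradient inequality at `0` and at `2 p`.
    have heq : F p μ = p ⬝ᵥ gradP F p μ := by
      have h1 := hsup 0 le_rfl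
      have h2 := hsup ((2 : ℝ) • p) (smul_nonneg zero_le_two hp0)
      have e1 : F 0 μ = 0 := by simp [hF, (h _).map_zero]
      have e2 : F ((2 : ℝ) • p) μ = 2 * F p μ := by
        simp only [hF, (h _).smul_eq hp0 zero_le_two, Finset.mul_sum]
        exact Finset.sum_congr rfl fun x _ => by ring
      rw [e1, zero_sub, zero_sub, neg_dotProduct] at h1
      rw [e2, sub_dotProduct, smul_dotProduct, smul_eq_mul] at h2
      linarith
    refine ⟨fun p' hp' => ?_, heq, fun i => ?_⟩
    · have := hsup p' hp'
      rw [sub_dotProduct, ← heq] at this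
      linarith
    · have hlim := tendsto_quotient_gradP hd hp0 (v := Pi.single i 1)
        (add_nonneg hp0 (Pi.single_nonneg.2 zero_le_one))
      rw [single_one_dotProduct] at hlim
      refine le_of_tendsto hlim ?_
      filter_upwards [self_mem_nhdsWithin] with t (ht : 0 < t)
      rw [div_le_iff₀ ht]
      have hq : 0 ≤ p + t • (Pi.single i 1 : ι → ℝ) :=
        add_nonneg hp0 (smul_nonneg ht.le (Pi.single_nonneg.2 zero_le_one))
      have hx : ∀ x, D x (p + t • (Pi.single i 1 : ι → ℝ)) ≤ D x p + C * t := fun x => by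
        refine ((h x).le_add_sum_abs (hC x) hp0 hq).trans (le_of_eq ?_)
        simp [Pi.single_apply, abs_of_pos ht, apply_ite abs]
      have := Finset.sum_le_sum fun x (_ : x ∈ Finset.univ) =>
        mul_le_mul_of_nonneg_left (hx x) (hμ.1 x)
      simp only [mul_add, Finset.sum_add_distrib] at this
      rw [← Finset.sum_mul (f := μ), hμ.2] at this
      simp only [hF]
      linarith
  refine convexHull_min ?_ ?_
  · rintro f ⟨ps, μs, hs, hps, hμs, hfs⟩
    have hDc : ∀ x, Tendsto (fun n => D x (ps n)) atTop (𝓝 (D x p)) := fun x =>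
      ((h x).continuousOn p hp).tendsto.comp (tendsto_nhdsWithin_iff.2
        ⟨hps, Eventually.of_forall fun n i => (hs n).1.1 i⟩)
    have hμx : ∀ x, Tendsto (fun n => μs n x) atTop (𝓝 (μ x)) := fun x =>
      (tendsto_pi_nhds.1 hμs) x
    refine ⟨fun p' hp' => ?_, ?_, fun i => ?_⟩
    · refine le_of_tendsto_of_tendsto (tendsto_finsetSum _ fun x _ => (hμx x).mul_const (D x p'))
        (tendsto_finsetSum _ fun i _ => ((tendsto_pi_nhds.1 hfs) i).const_mul (p' i)) ?_
      exact Eventually.of_forall fun n => (hpt _ _ (hs n).1 (hs n).2.1 (hs n).2.2).1 p' hp'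
    · refine tendsto_nhds_unique (tendsto_finsetSum _ fun x _ => (hμx x).mul (hDc x))
        ((tendsto_finsetSum _ fun i _ => ((tendsto_pi_nhds.1 hps) i).mul
          ((tendsto_pi_nhds.1 hfs) i)).congr fun n => ?_)
      exact (hpt _ _ (hs n).1 (hs n).2.1 (hs n).2.2).2.1.symm
    · exact le_of_tendsto' ((tendsto_pi_nhds.1 hfs) i) fun n =>
        (hpt _ _ (hs n).1 (hs n).2.1 (hs n).2.2).2.2 i
  · rintro f ⟨f1, f2, f3⟩ g ⟨g1, g2, g3⟩ a b ha hb hab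
    have e : ∀ c : ℝ, c = a * c + b * c := fun c => by rw [← add_mul, hab, one_mul]
    refine ⟨fun p' hp' => ?_, ?_, fun i => ?_⟩
    · rw [dotProduct_add, dotProduct_smul, dotProduct_smul, e (F p' μ)]
      exact add_le_add (mul_le_mul_of_nonneg_left (f1 p' hp') ha)
        (mul_le_mul_of_nonneg_left (g1 p' hp') hb)
    · rw [dotProduct_add, dotProduct_smul, dotProduct_smul, ← f2, ← g2]
      exact e _
    · rw [e (C : ℝ)]
      exact add_le_add (mul_le_mul_of_nonneg_left (f3 i) ha)
        (mul_le_mul_of_nonneg_left (g3 i) hb)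

end Game

/-! ### Convergence of self-play for scenario payoffs. -/

section Convergence

variable {E ι X : Type*} [NormedAddCommGroup E] [NormedSpace ℝ E] [Fintype ι] [Fintype X]
  {U : X → Set E} {φ : X → ι → E → ℝ} {D : X → (ι → ℝ) → ℝ}

lemma lmoP_subset_stdSimplex (F : (ι → ℝ) → (X → ℝ) → ℝ) (p : ι → ℝ) (μ : X → ℝ) :
    lmoP F p μ ⊆ stdSimplex ℝ ι :=
  convexHull_min (fun _ hq => hq.1) (convex_stdSimplex ℝ ι)

lemma add_smul_sub_mem_stdSimplex {κ : Type*} [Fintype κ] {p q : κ → ℝ} (hp : p ∈ stdSimplex ℝ κ)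
    (hq : q ∈ stdSimplex ℝ κ) (n : ℕ) :
    p + (1 / ((n : ℝ) + 1)) • (q - p) ∈ stdSimplex ℝ κ := by
  refine (convex_stdSimplex ℝ κ).add_smul_sub_mem hp hq ⟨by positivity, ?_⟩
  rw [div_le_one (by positivity)]
  linarith [n.cast_nonneg (α := ℝ)]

/-- The step size `1 / (n + 1)` makes the iterates running averages: `n • p n` just accumulates the
oracle answers. -/
lemma succ_smul_add_smul_sub {κ : Type*} (p q : κ → ℝ) (n : ℕ) :
    ((n + 1 : ℕ) : ℝ) • (p + (1 / ((n : ℝ) + 1)) • (q - p)) = (n : ℝ) • p + q := by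
  have : ((n : ℝ) + 1) ≠ 0 := by positivity
  ext i
  simp only [Pi.smul_apply, Pi.add_apply, Pi.sub_apply, smul_eq_mul]
  push_cast
  field_simp
  ring

/-- The total increment that a nonnegative process with increments at most `1` collects below the
level `T` is at most `T + 1`. -/
lemma sum_increments_below_le {a b : ℕ → ℝ} {T : ℝ} (hT : 0 ≤ T) (ha0 : a 0 = 0)
    (hstep : ∀ n, a (n + 1) = a n + b n) (hb0 : ∀ n, 0 ≤ b n) (hb1 : ∀ n, b n ≤ 1) (N : ℕ) :
    ∑ r ∈ Finset.range N, (if a r < T then b r else 0) ≤ T + 1 := by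
  -- The first bound carries the induction: a round that counts starts from a sum at most `a N < T`
  -- and adds at most `1`.
  suffices h : ∑ r ∈ Finset.range N, (if a r < T then b r else 0) ≤ a N ∧
      ∑ r ∈ Finset.range N, (if a r < T then b r else 0) ≤ T + 1 from h.2
  induction N with
  | zero => simp [ha0]; linarith
  | succ N ih =>
    rw [Finset.sum_range_succ, hstep]
    split_ifs with h
    · exact ⟨by linarith [ih.1], by linarith [ih.1, hb1 N]⟩
    · exact ⟨by linarith [ih.1, hb0 N], by linarith [ih.2]⟩

/-- Coordinatewise comparison of a supergradient with the gradient after a step: they differ little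
in the coordinates of large weight. -/
lemma supergradient_le (h : ∀ x, IsScenario (U x) (φ x) (D x)) {δ L : ℝ} (hL0 : 0 ≤ L)
    (hL : ∀ x, ∀ (i : ι) (p q : ι → ℝ) (u u' : E), 0 ≤ p → 0 ≤ q → ∑ j, q j ≤ 2 → L ≤ p i →
      u ∈ U x → u' ∈ U x → D x p = ∑ j, p j * φ x j u →
      D x (p + q) = ∑ j, (p + q) j * φ x j u' → φ x i u ≤ φ x i u' + δ)
    {P q f : ι → ℝ} {μ : X → ℝ} (hP : 0 ≤ P) (hq : q ∈ stdSimplex ℝ ι) (hμ : μ ∈ stdSimplex ℝ X)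
    (hf : ∀ p', 0 ≤ p' → ∑ x, μ x * D x p' ≤ p' ⬝ᵥ f) (hfP : ∑ x, μ x * D x P = P ⬝ᵥ f)
    {u' : X → E} (hu' : ∀ x, u' x ∈ U x)
    (eu' : ∀ x, D x (P + q) = ∑ j, (P + q) j * φ x j (u' x)) {i : ι} (hi : L + 1 ≤ P i) :
    f i ≤ ∑ x, μ x * φ x i (u' x) + δ := by
  classical
  have hP1 : 0 ≤ P - Pi.single i 1 := by
    intro j
    by_cases hj : j = i
    · subst hj; simp; linarith
    · simpa [hj] using hP j
  choose u hu eu hmin using fun x => (h x).exists_min hP1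
  have h1 : ∀ x, D x P ≤ D x (P - Pi.single i 1) + φ x i (u x) := by
    intro x
    obtain ⟨-, -, -, hm⟩ := (h x).exists_min hP
    refine (hm (u x) (hu x)).trans (le_of_eq ?_)
    rw [eu x]
    simp only [Pi.sub_apply, sub_mul, Finset.sum_sub_distrib]
    simp [Pi.single_apply]
  -- Testing the supergradient at `P - e_i` bounds `f i` by the loss from removing one unit of arm
  -- `i`.
  have h2 := hf _ hP1
  rw [sub_dotProduct, single_one_dotProduct, ← hfP] at h2
  have h3 : ∀ x, φ x i (u x) ≤ φ x i (u' x) + δ := by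
    intro x
    -- From `P - e_i` to `P + q` the mass `q + e_i` of total `2` is added, whence the bound `2` in
    -- the stability lemma and the threshold `L + 1` on `P i`.
    refine hL x i (P - Pi.single i 1) (q + Pi.single i 1) (u x) (u' x) hP1
      (add_nonneg (fun j => hq.1 j) (Pi.single_nonneg.2 zero_le_one)) ?_ ?_ (hu x) (hu' x) (eu x) ?_
    · simp only [Pi.add_apply, Finset.sum_add_distrib, hq.2]
      simp [Pi.single_apply]
      norm_num
    · simp; linarith
    · have e : P - Pi.single i 1 + (q + Pi.single i 1) = P + q := by abel
      rw [e]; exact eu' x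
  have h4 := Finset.sum_le_sum fun x (_ : x ∈ Finset.univ) =>
    mul_le_mul_of_nonneg_left ((h1 x).trans (add_le_add_right (h3 x) _)) (hμ.1 x)
  simp only [mul_add, Finset.sum_add_distrib] at h4
  rw [← Finset.sum_mul (f := μ), hμ.2] at h4
  linarith

/-- Frank–Wolfe self-play finds the value of the game. -/
theorem tendsto_payoff_of_isTrajectory [Nonempty X] (h : ∀ x, IsScenario (U x) (φ x) (D x))
    {p₀ : ι → ℝ} {μ₀ : X → ℝ} (hN : IsNash (fun p μ => ∑ x, μ x * D x p) p₀ μ₀)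
    {p : ℕ → ι → ℝ} {μ : ℕ → X → ℝ} (ht : IsTrajectory (fun p μ => ∑ x, μ x * D x p) p μ) :
    Tendsto (fun n => ∑ x, μ n x * D x (p n)) atTop (𝓝 (∑ x, μ₀ x * D x p₀)) := by
  classical
  obtain ⟨C, hC⟩ : ∃ C : ℝ≥0, ∀ x i, ∀ u ∈ U x, φ x i u ≤ C := by
    choose C hC using fun x => (h x).exists_bound
    refine ⟨∑ x, C x, fun x i u hu => (hC x i u hu).trans ?_⟩
    exact_mod_cast Finset.single_le_sum (f := C) (fun _ _ => zero_le) (Finset.mem_univ x)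
  obtain ⟨hp0, hμ0, hstep_p, hstep_μ⟩ := ht
  choose q hq hpq using hstep_p
  choose w hw hμw using hstep_μ
  set F : (ι → ℝ) → (X → ℝ) → ℝ := fun p μ => ∑ x, μ x * D x p with hF
  set v := ∑ x, μ₀ x * D x p₀ with hv
  have hqs : ∀ n, q n ∈ stdSimplex ℝ ι := fun n => lmoP_subset_stdSimplex _ _ _ (hq n)
  have hws : ∀ n, w n ∈ stdSimplex ℝ X := fun n => (hw n).1
  have hps : ∀ n, p n ∈ stdSimplex ℝ ι := by
    intro n
    induction n with
    | zero => exact hp0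
    | succ n ih => rw [hpq]; exact add_smul_sub_mem_stdSimplex ih (hqs n) n
  have hμs : ∀ n, μ n ∈ stdSimplex ℝ X := by
    intro n
    induction n with
    | zero => exact hμ0
    | succ n ih => rw [hμw]; exact add_smul_sub_mem_stdSimplex ih (hws n) n
  have hpnn : ∀ n, 0 ≤ p n := fun n i => (hps n).1 i
  set P : ℕ → ι → ℝ := fun n => (n : ℝ) • p n with hP
  -- The first step has size `1`, so the initial point leaves no trace in the cumulated play.
  have hP0 : P 0 = 0 := by simp [hP]
  have hPstep : ∀ n, P (n + 1) = P n + q n := fun n => by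
    simp only [hP]; rw [hpq, succ_smul_add_smul_sub]
  have hPnn : ∀ n, 0 ≤ P n := fun n => smul_nonneg n.cast_nonneg (hpnn n)
  have hPmono : Monotone P := monotone_nat_of_le_succ fun n => by
    rw [hPstep]; exact le_add_of_nonneg_right fun i => (hqs n).1 i
  have hPsum : ∀ n, ∑ i, P n i = n := fun n => by
    simp only [hP, Pi.smul_apply, smul_eq_mul, ← Finset.mul_sum, (hps n).2, mul_one]
  have hDP : ∀ x n, D x (P n) = n * D x (p n) := fun x n => (h x).smul_eq (hpnn n) n.cast_nonneg
  have hx0 : ∀ n, ∃ x₀, ∀ x, D x₀ (P n) ≤ D x (P n) := fun n =>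
    Finite.exists_min fun x => D x (P n)
  choose x₀ hx₀ using hx0
  -- the oracle of the minimizer
  have hcomp : ∀ x r, D (x₀ r) (P r) < D x (P r) → w r x = 0 := by
    intro x r hlt
    have hr : (0 : ℝ) < r := by
      rcases Nat.eq_zero_or_pos r with h0 | h0
      · subst h0
        rw [hP0, (h x).map_zero, (h (x₀ 0)).map_zero] at hlt
        exact absurd hlt (lt_irrefl _)
      · exact_mod_cast h0
    have hle : ∀ y, D (x₀ r) (p r) ≤ D y (p r) := fun y => by
      have := hx₀ r y
      rw [hDP, hDP] at this
      exact le_of_mul_le_mul_left this hr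
    have hlt' : D (x₀ r) (p r) < D x (p r) := by
      rw [hDP, hDP] at hlt
      exact lt_of_mul_lt_mul_left hlt hr.le
    have hopt := (hw r).2 _ (single_mem_stdSimplex ℝ (x₀ r))
    have e : gradMu F (p r) (μ r) = fun x => D x (p r) := funext fun x => gradMu_linear D _ _ x
    rw [e, single_one_dotProduct] at hopt
    have hsum : ∑ y, w r y * (D y (p r) - D (x₀ r) (p r)) ≤ 0 := by
      simp only [mul_sub, Finset.sum_sub_distrib]
      rw [← Finset.sum_mul (f := w r), (hws r).2]
      simp only [dotProduct] at hopt
      linarith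
    have hterm := (Finset.sum_eq_zero_iff_of_nonneg fun y _ =>
      mul_nonneg ((hws r).1 y) (sub_nonneg.2 (hle y))).1 (le_antisymm hsum
        (Finset.sum_nonneg fun y _ => mul_nonneg ((hws r).1 y) (sub_nonneg.2 (hle y)))) x
        (Finset.mem_univ x)
    rcases mul_eq_zero.1 hterm with h0 | h0
    · exact h0
    · linarith
  -- the smallest best-response value over the Clarke gradient
  set S : ℕ → Set ℝ := fun n => {a | ∃ f ∈ clarkeGrad F (p n) (μ n), ∀ i, f i ≤ a} with hS
  have hgrad : ∀ n, ∀ f ∈ clarkeGrad F (p n) (μ n),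
      (∀ p', 0 ≤ p' → ∑ x, μ n x * D x p' ≤ p' ⬝ᵥ f) ∧ ∑ x, μ n x * D x (p n) = p n ⬝ᵥ f ∧
        ∀ i, f i ≤ C := fun n f hf => clarkeGrad_supergradient h hC (hpnn n) hf
  have hSne : ∀ n, (S n).Nonempty := by
    intro n
    have hne : (lmoP F (p n) (μ n)).Nonempty := ⟨_, hq n⟩
    obtain ⟨q', -, f, hf, -⟩ := convexHull_nonempty_iff.1 hne
    exact ⟨C, f, hf, (hgrad n f hf).2.2⟩
  have hdot : ∀ {r f : ι → ℝ} {a : ℝ}, 0 ≤ r → (∀ i, f i ≤ a) → r ⬝ᵥ f ≤ (∑ i, r i) * a := by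
    intro r f a hr hf
    rw [Finset.sum_mul]
    exact Finset.sum_le_sum fun i _ => mul_le_mul_of_nonneg_left (hf i) (hr i)
  -- The equilibrium strategy `p₀` secures `v` against `μ n`, and a supergradient majorizes the
  -- payoff at `p₀`.
  have hSv : ∀ n, ∀ a ∈ S n, v ≤ a := by
    rintro n a ⟨f, hf, hfa⟩
    have h1 := (hgrad n f hf).1 p₀ fun i => hN.1.1 i
    have h2 := hdot (fun i => hN.1.1 i) hfa
    rw [hN.1.2, one_mul] at h2
    exact (hN.2.2.2 (μ n) (hμs n)).trans (h1.trans h2)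
  have hSb : ∀ n, BddBelow (S n) := fun n => ⟨v, hSv n⟩
  set m : ℕ → ℝ := fun n => n * sInf (S n) with hm
  have key := discrete_play_value (d := fun x n => D x (P n)) (M := fun x n => n * μ n x)
    (w := fun x n => w n x) (U := fun n => D (x₀ n) (P n)) (m := m) (C := C) (v := v)
    (fun x => by simp only [hP0]; exact (h x).map_zero)
    (fun x r s hrs => (h x).mono (hPnn r) (hPmono hrs))
    (fun x r => by
      have := (h x).le_add_sum_abs (hC x) (hPnn r) (hPnn (r + 1))
      refine this.trans (le_of_eq ?_)
      simp only [hPstep, Pi.add_apply, add_sub_cancel_left]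
      rw [Finset.sum_congr rfl fun i _ => abs_of_nonneg ((hqs r).1 i), (hqs r).2, mul_one])
    (fun x => by simp)
    (fun x r => by
      have := congrFun (succ_smul_add_smul_sub (μ r) (w r) r) x
      rw [← hμw] at this
      simpa using this)
    (fun x r => (hws r).1 x) (fun r => (hws r).2) (fun x r => hx₀ r x) (fun r => ⟨x₀ r, rfl⟩)
    hcomp ?_ ?_ ?_ ?_
  · refine key.congr' ?_
    filter_upwards [eventually_gt_atTop 0] with n hn
    have hn' : (n : ℝ) ≠ 0 := by exact_mod_cast hn.ne'
    rw [Finset.sum_div]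
    refine Finset.sum_congr rfl fun x _ => ?_
    rw [hDP]
    field_simp
  · intro s t hst
    have hfac : ∑ x, (s : ℝ) * μ s x * (D x (P t) - D x (P s)) =
        s * (∑ x, μ s x * D x (P t) - ∑ x, μ s x * D x (P s)) := by
      rw [← Finset.sum_sub_distrib, Finset.mul_sum]
      exact Finset.sum_congr rfl fun x _ => by ring
    -- By homogeneity `f` is also a supergradient at `P s`, and the mass `P t - P s` of total `t -
    -- s` earns at most `a` per unit.
    have hle : ∀ a ∈ S s, ∑ x, μ s x * D x (P t) - ∑ x, μ s x * D x (P s) ≤ ((t : ℝ) - s) * a := by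
      rintro a ⟨f, hf, hfa⟩
      obtain ⟨g1, g2, -⟩ := hgrad s f hf
      have e : ∑ x, μ s x * D x (P s) = P s ⬝ᵥ f := by
        rw [Finset.sum_congr rfl fun x _ => by rw [hDP x s]]
        simp only [hP, smul_dotProduct, smul_eq_mul, ← g2, Finset.mul_sum]
        exact Finset.sum_congr rfl fun x _ => by ring
      have h1 := hdot (sub_nonneg.2 (hPmono hst)) hfa
      rw [sub_dotProduct] at h1
      simp only [Pi.sub_apply, Finset.sum_sub_distrib, hPsum] at h1
      have := g1 (P t) (hPnn t)
      linarith
    simp only [hm]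
    rw [hfac, mul_left_comm]
    refine mul_le_mul_of_nonneg_left ?_ s.cast_nonneg
    rcases hst.eq_or_lt with rfl | hlt
    · simp
    · have hpos : (0 : ℝ) < (t : ℝ) - s := sub_pos.2 (by exact_mod_cast hlt)
      rw [← div_le_iff₀' hpos]
      refine le_csInf (hSne s) fun a ha => ?_
      rw [div_le_iff₀' hpos]
      exact hle a ha
  · intro δ hδ
    obtain ⟨L, hL0, hL⟩ : ∃ L : ℝ, 0 ≤ L ∧ ∀ x, ∀ (i : ι) (p q : ι → ℝ) (u u' : E), 0 ≤ p → 0 ≤ q →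
        ∑ j, q j ≤ 2 → L ≤ p i → u ∈ U x → u' ∈ U x → D x p = ∑ j, p j * φ x j u →
        D x (p + q) = ∑ j, (p + q) j * φ x j u' → φ x i u ≤ φ x i u' + δ := by
      choose L hL using fun x => (h x).exists_stability hδ
      refine ⟨∑ x, |L x|, Finset.sum_nonneg fun x _ => abs_nonneg _, ?_⟩
      intro x i p q u u' h1 h2 h3 h4
      refine hL x i p q u u' h1 h2 h3 (le_trans ((le_abs_self _).trans ?_) h4)
      exact Finset.single_le_sum (f := fun x => |L x|) (fun x _ => abs_nonneg _) (Finset.mem_univ x)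
    -- The loss in one round is `δ` plus `C` times the mass given to arms of cumulated weight below
    -- `L + 1`, all scaled by the round.
    have hround : ∀ r : ℕ, m r - ∑ x, r * μ r x * (D x (P (r + 1)) - D x (P r)) ≤
        r * (δ + C * ∑ i, if P r i < L + 1 then q r i else 0) := by
      intro r
      choose u' hu' eu' _ using fun x => (h x).exists_min (hPnn (r + 1))
      have hinc : ∀ x, ∑ i, q r i * φ x i (u' x) ≤ D x (P (r + 1)) - D x (P r) := by
        intro x
        obtain ⟨-, -, -, hmin⟩ := (h x).exists_min (hPnn r)
        have h1 := hmin (u' x) (hu' x)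
        have h2 := eu' x
        rw [hPstep] at h2
        simp only [Pi.add_apply, add_mul, Finset.sum_add_distrib] at h2
        rw [hPstep, h2]
        linarith
      set ℓ : ι → ℝ := fun i => ∑ x, μ r x * φ x i (u' x) with hℓ
      -- The oracle mixes best responses to different Clarke gradients, so a common majorant of all
      -- of them is needed: stability controls the heavy coordinates, the crude bound `C` the
      -- others.
      set b : ι → ℝ := fun i => ℓ i + δ + if P r i < L + 1 then (C : ℝ) else 0 with hb
      have hℓ0 : ∀ i, 0 ≤ ℓ i := fun i => Finset.sum_nonneg fun x _ =>
        mul_nonneg ((hμs r).1 x) ((h x).nonneg i _ (hu' x))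
      have hfb : ∀ f ∈ clarkeGrad F (p r) (μ r), ∀ i, f i ≤ b i := by
        intro f hf i
        obtain ⟨g1, g2, g3⟩ := hgrad r f hf
        simp only [hb]
        split_ifs with hi
        · linarith [g3 i, hℓ0 i]
        · rw [add_zero]
          refine supergradient_le h hL0 hL (hPnn r) (hqs r) (hμs r) g1 ?_ hu'
            (fun x => by rw [← hPstep]; exact eu' x) (not_lt.1 hi)
          rw [Finset.sum_congr rfl fun x _ => by rw [hDP x r]]
          simp only [hP, smul_dotProduct, smul_eq_mul, ← g2, Finset.mul_sum]
          exact Finset.sum_congr rfl fun x _ => by ring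
      have hq' : sInf (S r) ≤ q r ⬝ᵥ b := by
        have hsub : lmoP F (p r) (μ r) ⊆ {q | sInf (S r) ≤ q ⬝ᵥ b} := by
          refine convexHull_min ?_ ?_
          · rintro q' ⟨hq's, f, hf, hmax⟩
            have h1 : sInf (S r) ≤ q' ⬝ᵥ f := csInf_le (hSb r) ⟨f, hf, fun i => by
              have := hmax _ (single_mem_stdSimplex ℝ i)
              rwa [single_one_dotProduct] at this⟩
            exact h1.trans (Finset.sum_le_sum fun i _ =>
              mul_le_mul_of_nonneg_left (hfb f hf i) (hq's.1 i))
          · intro a ha c hc α β hα hβ hαβ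
            simp only [Set.mem_ofPred_eq, add_dotProduct, smul_dotProduct, smul_eq_mul] at *
            have e : sInf (S r) = α * sInf (S r) + β * sInf (S r) := by
              rw [← add_mul, hαβ, one_mul]
            rw [e]
            exact add_le_add (mul_le_mul_of_nonneg_left ha hα) (mul_le_mul_of_nonneg_left hc hβ)
        exact hsub (hq r)
      have e1 : q r ⬝ᵥ b = (∑ i, q r i * ℓ i) + δ +
          C * ∑ i, if P r i < L + 1 then q r i else 0 := by
        simp only [dotProduct, hb, mul_add, Finset.sum_add_distrib]
        rw [← Finset.sum_mul, (hqs r).2, one_mul, Finset.mul_sum]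
        congr 1
        refine Finset.sum_congr rfl fun i _ => ?_
        split_ifs <;> ring
      have e2 : ∑ i, q r i * ℓ i = ∑ x, μ r x * ∑ i, q r i * φ x i (u' x) := by
        simp only [hℓ, Finset.mul_sum]
        rw [Finset.sum_comm]
        exact Finset.sum_congr rfl fun x _ => Finset.sum_congr rfl fun i _ => by ring
      have e3 : ∑ i, q r i * ℓ i ≤ ∑ x, μ r x * (D x (P (r + 1)) - D x (P r)) := by
        rw [e2]
        exact Finset.sum_le_sum fun x _ => mul_le_mul_of_nonneg_left (hinc x) ((hμs r).1 x)
      have e4 : ∑ x, (r : ℝ) * μ r x * (D x (P (r + 1)) - D x (P r)) =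
          r * ∑ x, μ r x * (D x (P (r + 1)) - D x (P r)) := by
        rw [Finset.mul_sum]; exact Finset.sum_congr rfl fun x _ => by ring
      rw [e4]
      simp only [hm]
      rw [← mul_sub]
      refine mul_le_mul_of_nonneg_left ?_ r.cast_nonneg
      linarith
    -- Each arm receives total mass at most `L + 2` while its weight is below `L + 1`; the other
    -- factor `N` bounds the round.
    refine ⟨C * ∑ i : ι, (L + 1 + 1), fun N => ?_⟩
    have hlevel : ∀ i, ∑ r ∈ Finset.range N, (if P r i < L + 1 then q r i else 0) ≤ L + 1 + 1 := by
      intro i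
      refine sum_increments_below_le (by linarith) (by rw [hP0]; rfl)
        (fun n => by rw [hPstep]; rfl) (fun n => (hqs n).1 i) (fun n => ?_) N
      rw [← (hqs n).2]
      exact Finset.single_le_sum (f := q n) (fun j _ => (hqs n).1 j) (Finset.mem_univ i)
    have hnn : ∀ r, 0 ≤ ∑ i, (if P r i < L + 1 then q r i else 0) := fun r =>
      Finset.sum_nonneg fun i _ => by
        split_ifs
        · exact (hqs r).1 i
        · exact le_rfl
    calc _ ≤ ∑ r ∈ Finset.range N, (N : ℝ) *
          (δ + C * ∑ i, if P r i < L + 1 then q r i else 0) := by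
          refine Finset.sum_le_sum fun r hr => (hround r).trans ?_
          have h1 : (r : ℝ) ≤ N := by exact_mod_cast (Finset.mem_range.1 hr).le
          have h2 := hnn r
          gcongr
      _ = δ * N ^ 2 + C * N * ∑ i, ∑ r ∈ Finset.range N,
          (if P r i < L + 1 then q r i else 0) := by
          rw [← Finset.mul_sum, Finset.sum_add_distrib, ← Finset.mul_sum, Finset.sum_comm]
          simp only [Finset.sum_const, Finset.card_range, nsmul_eq_mul]
          ring
      _ ≤ δ * N ^ 2 + C * N * ∑ i : ι, (L + 1 + 1) := by
          gcongr with i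
          exact hlevel i
      _ = _ := by ring
  · intro r
    exact mul_le_mul_of_nonneg_left (le_csInf (hSne r) (hSv r)) r.cast_nonneg
  · intro r
    -- The minimum over scenarios is at most the `μ₀`-average, and no `p` earns more than `v`
    -- against `μ₀`.
    have h1 : ∑ x, μ₀ x * D (x₀ r) (P r) ≤ ∑ x, μ₀ x * D x (P r) :=
      Finset.sum_le_sum fun x _ => mul_le_mul_of_nonneg_left (hx₀ r x) (hN.2.1.1 x)
    rw [← Finset.sum_mul, hN.2.1.2, one_mul] at h1
    refine h1.trans ?_
    have h2 : ∑ x, μ₀ x * D x (P r) = r * ∑ x, μ₀ x * D x (p r) := by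
      rw [Finset.mul_sum]
      exact Finset.sum_congr rfl fun x _ => by rw [hDP]; ring
    rw [h2]
    exact mul_le_mul_of_nonneg_left (hN.2.2.1 (p r) (hps r)) r.cast_nonneg

/-- The game has a saddle point. -/
theorem exists_isNash [Nonempty X] [Nonempty ι] (h : ∀ x, IsScenario (U x) (φ x) (D x)) :
    ∃ p μ, IsNash (fun p μ => ∑ x, μ x * D x p) p μ := by
  classical
  have hlin : ∀ p, IsLinearMap ℝ fun μ : X → ℝ => ∑ x, μ x * D x p := fun p =>
    ⟨fun a b => by simp [add_mul, Finset.sum_add_distrib],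
      fun c a => by simp [Finset.mul_sum, mul_assoc]⟩
  obtain ⟨μ, hμ, p, hp, hs⟩ := Sion.exists_isSaddlePointOn (X := stdSimplex ℝ X)
    (Y := stdSimplex ℝ ι) (f := fun (μ : X → ℝ) (p : ι → ℝ) => ∑ x, μ x * D x p)
    ⟨_, single_mem_stdSimplex ℝ (Classical.arbitrary X)⟩ (convex_stdSimplex ℝ X)
    (isCompact_stdSimplex ℝ X)
    (fun p _ => (by fun_prop : Continuous fun μ : X → ℝ =>
      ∑ x, μ x * D x p).continuousOn.lowerSemicontinuousOn)
    (fun p _ => (ConvexOn.quasiconvexOn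
      (((hlin p).mk' _).convexOn (convex_stdSimplex ℝ X))))
    (convex_stdSimplex ℝ ι) ⟨_, single_mem_stdSimplex ℝ (Classical.arbitrary ι)⟩
    (isCompact_stdSimplex ℝ ι)
    (fun μ _ => ContinuousOn.upperSemicontinuousOn (continuousOn_finsetSum _ fun x _ =>
      continuousOn_const.mul ((h x).continuousOn.mono fun p hp => fun i => hp.1 i)))
    (fun μ hμ => ConcaveOn.quasiconcaveOn ⟨convex_stdSimplex ℝ ι, fun p hp q hq a b ha hb _ => by
      simp only [smul_eq_mul, Finset.mul_sum, ← Finset.sum_add_distrib]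
      refine Finset.sum_le_sum fun x _ => ?_
      have hp0 : 0 ≤ p := fun i => hp.1 i
      have hq0 : 0 ≤ q := fun i => hq.1 i
      have h1 := (h x).add_le (smul_nonneg ha hp0) (smul_nonneg hb hq0)
      rw [(h x).smul_eq hp0 ha, (h x).smul_eq hq0 hb] at h1
      have h2 := mul_le_mul_of_nonneg_left h1 (hμ.1 x)
      linarith⟩)
  exact ⟨p, μ, hp, hμ, fun p' hp' => hs μ hμ p' hp', fun μ' hμ' => hs μ' hμ' p hp⟩

lemma IsNash.payoff_le {F : (ι → ℝ) → (X → ℝ) → ℝ} {p p' : ι → ℝ} {μ μ' : X → ℝ}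
    (h : IsNash F p μ) (h' : IsNash F p' μ') : F p μ ≤ F p' μ' :=
  (h.2.2.2 μ' h'.2.1).trans (h'.2.2.1 p h.1)

/-- The game has a value, and Frank–Wolfe self-play finds it. -/
theorem exists_gameValue_and_tendsto [Nonempty X] [Nonempty ι]
    (h : ∀ x, IsScenario (U x) (φ x) (D x)) :
    ∃ v : ℝ, IsGameValue (fun p μ => ∑ x, μ x * D x p) v ∧
      ∀ (p : ℕ → ι → ℝ) (μ : ℕ → X → ℝ), IsTrajectory (fun p μ => ∑ x, μ x * D x p) p μ →
        Tendsto (fun n => ∑ x, μ n x * D x (p n)) atTop (𝓝 v) := by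
  obtain ⟨p, μ, hN⟩ := exists_isNash h
  exact ⟨_, ⟨⟨p, μ, hN⟩, fun p' μ' hN' => le_antisymm (hN'.payoff_le hN) (hN.payoff_le hN')⟩,
    fun _ _ ht => tendsto_payoff_of_isTrajectory h hN ht⟩

end Convergence

/-- Used to trade an open scenario `S`, where the infimum need not be attained, for a compact piece
`T` of its boundary. -/
lemma sInf_eq_of_approx {S T : Set ℝ} (hT : T.Nonempty) (hS0 : ∀ a ∈ S, 0 ≤ a)
    (hT0 : ∀ b ∈ T, 0 ≤ b) (h1 : ∀ a ∈ S, ∃ b ∈ T, b ≤ a)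
    (h2 : ∀ b ∈ T, ∀ ε > 0, ∃ a ∈ S, a ≤ b + ε) : sInf S = sInf T := by
  have hS : S.Nonempty := by
    obtain ⟨b, hb⟩ := hT
    obtain ⟨a, ha, -⟩ := h2 b hb 1 one_pos
    exact ⟨a, ha⟩
  refine le_antisymm (le_csInf hT fun b hb => le_of_forall_pos_le_add fun ε hε => ?_)
    (le_csInf hS fun a ha => ?_)
  · obtain ⟨a, ha, hab⟩ := h2 b hb ε hε
    exact (csInf_le ⟨0, hS0⟩ ha).trans hab
  · obtain ⟨b, hb, hba⟩ := h1 a ha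
    exact (csInf_le ⟨0, hT0⟩ hb).trans hba

/-! ### Divergence from an exponential tilt, shared by both models. -/

section Tilting

open InformationTheory

/-- The divergence of a probability measure from an exponential tilt of it. -/
lemma toReal_klDiv_tilted {μ : Measure ℝ} [IsProbabilityMeasure μ] {t : ℝ}
    (hid : Integrable (fun y : ℝ => y) μ) (hexp : Integrable (fun y => Real.exp (t * y)) μ) :
    klDiv μ (μ.tilted fun y => t * y) ≠ ∞ ∧ (klDiv μ (μ.tilted fun y => t * y)).toReal =
      Real.log (∫ y, Real.exp (t * y) ∂μ) - t * ∫ y, y ∂μ := by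
  have hac : μ ≪ μ.tilted fun y => t * y := absolutelyContinuous_tilted hexp
  have hself : Integrable (llr μ μ) μ := (integrable_congr (llr_self μ)).2 (integrable_zero _ _ _)
  have hpm : IsProbabilityMeasure (μ.tilted fun y => t * y) := isProbabilityMeasure_tilted hexp
  refine ⟨klDiv_ne_top hac
    (integrable_llr_tilted_right .rfl (hid.const_mul t) hself hexp), ?_⟩
  rw [toReal_klDiv_of_measure_eq hac (by simp),
    integral_llr_tilted_right .rfl (hid.const_mul t) hexp hself, integral_congr_ae (llr_self μ),
    integral_const_mul]
  simp
  ring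

end Tilting

/-! ### Unstructured exponential-family bandits. -/

section ExponentialFamily

open InformationTheory

variable {ν : Measure ℝ} {a b c : ℝ}

lemma integrable_exp_of_mem_natSpace (ha : a ∈ natSpace ν) :
    Integrable (fun y => Real.exp (a * y)) ν :=
  integrable_of_mem_integrableExpSet (X := id) (interior_subset ha)

lemma convex_natSpace (ν : Measure ℝ) : Convex ℝ (natSpace ν) := convex_integrableExpSet.interior

lemma isProbabilityMeasure_natDist [NeZero ν] (ha : a ∈ natSpace ν) :
    IsProbabilityMeasure (natDist ν a) :=
  isProbabilityMeasure_tilted (integrable_exp_of_mem_natSpace ha)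

lemma integrable_id_natDist (ha : a ∈ natSpace ν) : Integrable (fun y : ℝ => y) (natDist ν a) :=
  memLp_one_iff_integrable.1 (memLp_tilted_mul (X := id) ha 1)

lemma natDist_eq_tilted (ha : a ∈ natSpace ν) (b : ℝ) :
    natDist ν b = (natDist ν a).tilted fun y => (b - a) * y := by
  unfold natDist
  rw [tilted_tilted (integrable_exp_of_mem_natSpace ha)]
  congr 1
  ext y
  simp only [Pi.add_apply]
  ring

/-- The divergence between two members of the family, as a function of natural parameters. -/
def natKL (ν : Measure ℝ) (a b : ℝ) : ℝ := (klDiv (natDist ν a) (natDist ν b)).toReal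

lemma natKL_nonneg (ν : Measure ℝ) (a b : ℝ) : 0 ≤ natKL ν a b := ENNReal.toReal_nonneg

lemma integrable_exp_natDist (ha : a ∈ natSpace ν) (hb : b ∈ natSpace ν) :
    Integrable (fun y => Real.exp ((b - a) * y)) (natDist ν a) := by
  unfold natDist
  rw [integrable_tilted_iff (integrable_exp_of_mem_natSpace ha)]
  refine (integrable_exp_of_mem_natSpace hb).congr (Eventually.of_forall fun y => ?_)
  simp only [smul_eq_mul, ← Real.exp_add]
  congr 1
  ring

/-- The divergence is the Bregman divergence of the cumulant generating function. This yields the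
identities below by algebra, and convexity in the second natural parameter. -/
lemma natKL_eq [NeZero ν] (ha : a ∈ natSpace ν) (hb : b ∈ natSpace ν) :
    natKL ν a b = cgf id ν b - cgf id ν a - (b - a) * natMean ν a := by
  have := isProbabilityMeasure_natDist ha
  have h1 := (toReal_klDiv_tilted (integrable_id_natDist ha) (integrable_exp_natDist ha hb)).2
  rw [← natDist_eq_tilted ha b] at h1
  rw [natKL, h1, natMean]
  congr 1
  have e : ∫ y, Real.exp ((b - a) * y) ∂natDist ν a = mgf id ν b / mgf id ν a := by
    unfold natDist
    rw [integral_exp_tilted]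
    simp only [mgf, id, Pi.add_apply]
    congr 2
    ext y
    congr 1
    ring
  rw [e, Real.log_div, cgf, cgf]
  · exact (mgf_pos' (NeZero.ne ν) (integrable_exp_of_mem_natSpace hb)).ne'
  · exact (mgf_pos' (NeZero.ne ν) (integrable_exp_of_mem_natSpace ha)).ne'

lemma natDist_eq_of_natKL_eq_zero [NeZero ν] (ha : a ∈ natSpace ν) (hb : b ∈ natSpace ν)
    (h : natKL ν a b = 0) : natDist ν a = natDist ν b := by
  have := isProbabilityMeasure_natDist ha
  have := isProbabilityMeasure_natDist hb
  have h1 := (toReal_klDiv_tilted (integrable_id_natDist ha) (integrable_exp_natDist ha hb)).1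
  rw [← natDist_eq_tilted ha b] at h1
  -- Finiteness `h1` matters: `toReal` also sends `∞` to `0`.
  exact klDiv_eq_zero_iff.1 (((ENNReal.toReal_eq_zero_iff _).1 h).resolve_right h1)

lemma natKL_self [NeZero ν] (ha : a ∈ natSpace ν) : natKL ν a a = 0 := by
  rw [natKL_eq ha ha]; ring

lemma continuousOn_natKL [NeZero ν] (ha : a ∈ natSpace ν) :
    ContinuousOn (natKL ν a) (natSpace ν) := by
  have h : ContinuousOn (fun b => cgf id ν b - cgf id ν a - (b - a) * natMean ν a) (natSpace ν) :=
    ((analyticOnNhd_cgf (X := id) (μ := ν)).continuousOn.sub continuousOn_const).sub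
      (by fun_prop)
  exact h.congr fun b hb => natKL_eq ha hb

/-- The three-point identity. -/
lemma natKL_add [NeZero ν] (ha : a ∈ natSpace ν) (hb : b ∈ natSpace ν) (hc : c ∈ natSpace ν) :
    natKL ν a c = natKL ν a b + natKL ν b c + (c - b) * (natMean ν b - natMean ν a) := by
  rw [natKL_eq ha hc, natKL_eq ha hb, natKL_eq hb hc]; ring

lemma mul_natMean_sub_eq [NeZero ν] (ha : a ∈ natSpace ν) (hb : b ∈ natSpace ν) :
    (b - a) * (natMean ν b - natMean ν a) = natKL ν a b + natKL ν b a := by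
  rw [natKL_eq ha hb, natKL_eq hb ha]; ring

lemma natMean_le_of_le [NeZero ν] (ha : a ∈ natSpace ν) (hb : b ∈ natSpace ν) (hab : a ≤ b) :
    natMean ν a ≤ natMean ν b := by
  rcases hab.eq_or_lt with rfl | hlt
  · exact le_rfl
  · have h := mul_natMean_sub_eq ha hb
    by_contra! hn
    nlinarith [natKL_nonneg ν a b, natKL_nonneg ν b a]

/-- If two members with distinct natural parameters coincide then all means coincide. -/
lemma natMean_eq_of_natDist_eq [NeZero ν] (ha : a ∈ natSpace ν) (hb : b ∈ natSpace ν)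
    (hab : a ≠ b) (h : natDist ν a = natDist ν b) (hc : c ∈ natSpace ν) :
    natMean ν c = natMean ν a := by
  have := isProbabilityMeasure_natDist ha
  have := isProbabilityMeasure_natDist hc
  have hexp := integrable_exp_natDist ha hb
  have h1 := rnDeriv_tilted_left_self (μ := natDist ν a) (f := fun y => (b - a) * y) (by fun_prop)
  rw [← natDist_eq_tilted ha b, ← h] at h1
  set Z := ∫ y, Real.exp ((b - a) * y) ∂natDist ν a with hZ
  -- A nontrivial tilt that changes nothing has a constant density, so the measure is concentrated
  -- at one point.
  have hconst : ∀ᵐ y ∂natDist ν a, y = Real.log Z / (b - a) := by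
    filter_upwards [h1, (natDist ν a).rnDeriv_self] with y hy1 hy2
    rw [hy2] at hy1
    have hpos : 0 < Z := integral_exp_pos hexp
    have h3 : Real.exp ((b - a) * y) / Z = 1 := by
      have h4 := congrArg ENNReal.toReal hy1
      rw [ENNReal.toReal_ofReal (by positivity)] at h4
      simpa using h4.symm
    rw [div_eq_one_iff_eq hpos.ne'] at h3
    rw [← h3, Real.log_exp, mul_div_cancel_left₀ _ (sub_ne_zero.2 hab.symm)]
  have hac : natDist ν c ≪ natDist ν a := by
    rw [natDist_eq_tilted ha c]; exact tilted_absolutelyContinuous _ _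
  have hm : ∀ d, IsProbabilityMeasure (natDist ν d) → natDist ν d ≪ natDist ν a →
      natMean ν d = Real.log Z / (b - a) := by
    intro d _ hd
    unfold natMean
    rw [integral_congr_ae (hd.ae_le hconst)]
    simp
  rw [hm c ‹_› hac, hm a ‹_› .rfl]

/-- The two distinct means `m`, `m'` exclude the degenerate family in which all members coincide. -/
lemma natMean_lt_of_lt [NeZero ν] {m m' : ℝ} (hm : m ∈ meanSpace ν) (hm' : m' ∈ meanSpace ν)
    (hmm : m ≠ m') (ha : a ∈ natSpace ν) (hb : b ∈ natSpace ν) (hab : a < b) :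
    natMean ν a < natMean ν b := by
  refine lt_of_le_of_ne (natMean_le_of_le ha hb hab.le) fun heq => hmm ?_
  have h0 := mul_natMean_sub_eq ha hb
  rw [heq, sub_self, mul_zero] at h0
  have h1 : natKL ν a b = 0 := by linarith [natKL_nonneg ν a b, natKL_nonneg ν b a]
  have h2 := natDist_eq_of_natKL_eq_zero ha hb h1
  obtain ⟨c, hc, rfl⟩ := hm
  obtain ⟨c', hc', rfl⟩ := hm'
  rw [natMean_eq_of_natDist_eq ha hb hab.ne h2 hc, natMean_eq_of_natDist_eq ha hb hab.ne h2 hc']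

/-- In the three-point identity the cross term is a product of two factors of equal sign, since
means increase with the natural parameter. -/
lemma natKL_anti [NeZero ν] (ha : a ∈ natSpace ν) (hb : b ∈ natSpace ν) (hc : c ∈ natSpace ν)
    (hcb : c ≤ b) (hba : b ≤ a) : natKL ν a b ≤ natKL ν a c := by
  rw [natKL_add ha hb hc]
  nlinarith [natKL_nonneg ν b c, natMean_le_of_le hb ha hba]

lemma natKL_mono [NeZero ν] (ha : a ∈ natSpace ν) (hb : b ∈ natSpace ν) (hc : c ∈ natSpace ν)
    (hab : a ≤ b) (hbc : b ≤ c) : natKL ν a b ≤ natKL ν a c := by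
  rw [natKL_add ha hb hc]
  nlinarith [natKL_nonneg ν b c, natMean_le_of_le ha hb hab]

lemma half_add_mem_natSpace (hb : b ∈ natSpace ν) (hc : c ∈ natSpace ν) :
    (1 / 2 : ℝ) • (b + c) ∈ natSpace ν := by
  rw [smul_add]
  exact convex_natSpace ν hb hc (by norm_num) (by norm_num) (by norm_num)

/-- The Jensen gap at the midpoint is itself an average of divergences, because the linear cross
terms cancel. A zero gap therefore forces both endpoints to give the same distribution. -/
lemma natKL_half_add [NeZero ν] (ha : a ∈ natSpace ν) (hb : b ∈ natSpace ν)
    (hc : c ∈ natSpace ν) : (natKL ν a b + natKL ν a c) / 2 = natKL ν a ((1 / 2 : ℝ) • (b + c)) +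
      (natKL ν ((1 / 2 : ℝ) • (b + c)) b + natKL ν ((1 / 2 : ℝ) • (b + c)) c) / 2 := by
  have hd := half_add_mem_natSpace hb hc
  rw [natKL_add ha hd hb, natKL_add ha hd hc]
  simp only [smul_eq_mul]
  ring

lemma natKL_half_add_le [NeZero ν] (ha : a ∈ natSpace ν) (hb : b ∈ natSpace ν)
    (hc : c ∈ natSpace ν) :
    natKL ν a ((1 / 2 : ℝ) • (b + c)) ≤ (natKL ν a b + natKL ν a c) / 2 := by
  rw [natKL_half_add ha hb hc]
  linarith [natKL_nonneg ν ((1 / 2 : ℝ) • (b + c)) b, natKL_nonneg ν ((1 / 2 : ℝ) • (b + c)) c]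

lemma natKL_half_add_lt [NeZero ν] (ha : a ∈ natSpace ν) (hb : b ∈ natSpace ν)
    (hc : c ∈ natSpace ν) (hne : natKL ν a b ≠ natKL ν a c) :
    natKL ν a ((1 / 2 : ℝ) • (b + c)) < (natKL ν a b + natKL ν a c) / 2 := by
  refine lt_of_le_of_ne (natKL_half_add_le ha hb hc) fun heq => hne ?_
  rw [natKL_half_add ha hb hc] at heq
  have hd := half_add_mem_natSpace hb hc
  have n1 := natKL_nonneg ν ((1 / 2 : ℝ) • (b + c)) b
  have n2 := natKL_nonneg ν ((1 / 2 : ℝ) • (b + c)) c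
  have h1 := natDist_eq_of_natKL_eq_zero hd hb (by linarith)
  have h2 := natDist_eq_of_natKL_eq_zero hd hc (by linarith)
  rw [natKL, natKL, ← h1, ← h2]

variable {K : ℕ}

/-- The natural parameter that represents the member with mean `m`. -/
def natParam (ν : Measure ℝ) (m : ℝ) : ℝ := Function.invFunOn (natMean ν) (natSpace ν) m

lemma natParam_mem {m : ℝ} (hm : m ∈ meanSpace ν) : natParam ν m ∈ natSpace ν :=
  Function.invFunOn_mem hm

lemma natMean_natParam {m : ℝ} (hm : m ∈ meanSpace ν) : natMean ν (natParam ν m) = m :=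
  Function.invFunOn_eq hm

lemma armMean_expModel {ϑ : Fin K → ℝ} {i : Fin K} (h : ϑ i ∈ meanSpace ν) :
    armMean (expModel ν K) ϑ i = ϑ i := natMean_natParam h

lemma information_expModel (θ ϑ p : Fin K → ℝ) : information (expModel ν K) θ p ϑ =
    ∑ i, p i * natKL ν (natParam ν (θ i)) (natParam ν (ϑ i)) := rfl

/-- The divergences on the boundary of the scenario `x`, where the arms `I` and `x` have the common
natural parameter `u`. -/
def tieKL (ν : Measure ℝ) (θ : Fin K → ℝ) (I x i : Fin K) (u : ℝ) : ℝ :=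
  if i = I ∨ i = x then natKL ν (natParam ν (θ i)) u else 0

lemma information_nonneg {Θ ι : Type*} [Fintype ι] (P : Θ → ι → Measure ℝ) (θ ϑ : Θ) {p : ι → ℝ}
    (hp : 0 ≤ p) : 0 ≤ information P θ p ϑ :=
  Finset.sum_nonneg fun i _ => mul_nonneg (hp i) ENNReal.toReal_nonneg

/-- The scenarios of the unstructured bandit. -/
theorem isScenario_expModel [NeZero ν] {θ : Fin K → ℝ} (hθ : θ ∈ expParams ν K) {I x : Fin K}
    (hlt : θ x < θ I) : IsScenario (Set.Icc (natParam ν (θ x)) (natParam ν (θ I)))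
      (tieKL ν θ I x) (fun p => scenarioPayoff (expModel ν K) (expParams ν K) θ I p x) := by
  have hη : ∀ i, natParam ν (θ i) ∈ natSpace ν := fun i => natParam_mem (hθ i)
  have hm : ∀ i, natMean ν (natParam ν (θ i)) = θ i := fun i => natMean_natParam (hθ i)
  have hstrict : ∀ {a b : ℝ}, a ∈ natSpace ν → b ∈ natSpace ν → a < b →
      natMean ν a < natMean ν b := natMean_lt_of_lt (hθ x) (hθ I) hlt.ne
  -- Strict monotonicity of the mean makes the chosen inverse a genuine one.
  have hinv : ∀ {a : ℝ}, a ∈ natSpace ν → natParam ν (natMean ν a) = a := by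
    intro a ha
    have hmem : natMean ν a ∈ meanSpace ν := ⟨a, ha, rfl⟩
    have h1 := natMean_natParam hmem
    rcases lt_trichotomy (natParam ν (natMean ν a)) a with h | h | h
    · exact absurd h1 (hstrict (natParam_mem hmem) ha h).ne
    · exact h
    · exact absurd h1 (hstrict ha (natParam_mem hmem) h).ne'
  have hxI : x ≠ I := by rintro rfl; exact lt_irrefl _ hlt
  have hηlt : natParam ν (θ x) < natParam ν (θ I) := by
    by_contra! hle
    have := natMean_le_of_le (hη I) (hη x) hle
    rw [hm, hm] at this
    linarith
  have hsub : Set.Icc (natParam ν (θ x)) (natParam ν (θ I)) ⊆ natSpace ν :=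
    (convex_natSpace ν).ordConnected.out (hη x) (hη I)
  have hsum : ∀ (p : Fin K → ℝ) (u : ℝ), ∑ i, p i * tieKL ν θ I x i u =
      p I * natKL ν (natParam ν (θ I)) u + p x * natKL ν (natParam ν (θ x)) u := by
    intro p u
    rw [← Finset.sum_subset (Finset.subset_univ {I, x}), Finset.sum_pair hxI.symm]
    · simp [tieKL]
    · intro i _ hi
      have : ¬(i = I ∨ i = x) := by simpa using hi
      simp [tieKL, this]
  refine ⟨isCompact_Icc, ⟨_, Set.left_mem_Icc.2 hηlt.le⟩, fun i => ?_, fun i u _ => ?_,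
    fun u hu u' hu' => ?_, fun i u hu u' hu' => ?_, fun i u hu u' hu' hne => ?_, fun p hp => ?_⟩
  · by_cases hi : i = I ∨ i = x
    · have e : tieKL ν θ I x i = natKL ν (natParam ν (θ i)) := funext fun u => if_pos hi
      rw [e]
      exact (continuousOn_natKL (hη i)).mono hsub
    · have e : tieKL ν θ I x i = fun _ => 0 := funext fun u => if_neg hi
      rw [e]
      exact continuousOn_const
  · unfold tieKL
    split_ifs
    · exact natKL_nonneg _ _ _
    · exact le_rfl
  · rw [smul_add]
    exact convex_Icc _ _ hu hu' (by norm_num) (by norm_num) (by norm_num)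
  · unfold tieKL
    split_ifs
    · exact natKL_half_add_le (hη i) (hsub hu) (hsub hu')
    · simp
  · unfold tieKL at *
    split_ifs at * with hi
    · exact natKL_half_add_lt (hη i) (hsub hu) (hsub hu') hne
    · exact absurd rfl hne
  · refine sInf_eq_of_approx ⟨_, _, Set.left_mem_Icc.2 hηlt.le, rfl⟩ ?_ ?_ ?_ ?_
    · rintro _ ⟨ϑ, -, rfl⟩
      exact information_nonneg _ _ _ hp
    · rintro _ ⟨u, -, rfl⟩
      simp only [hsum]
      exact add_nonneg (mul_nonneg (hp I) (natKL_nonneg _ _ _))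
        (mul_nonneg (hp x) (natKL_nonneg _ _ _))
    · rintro _ ⟨ϑ, ⟨hϑ, hmean⟩, rfl⟩
      rw [armMean_expModel (hϑ I), armMean_expModel (hϑ x)] at hmean
      have hI := natParam_mem (hϑ I)
      have hx := natParam_mem (hϑ x)
      have hord : natParam ν (ϑ I) < natParam ν (ϑ x) := by
        by_contra! hle
        have := natMean_le_of_le hx hI hle
        rw [natMean_natParam (hϑ I), natMean_natParam (hϑ x)] at this
        linarith
      -- The common parameter is that of arm `I` under `ϑ`, clamped to the interval; divergences
      -- grow away from the true parameters, so neither arm pays more.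
      obtain ⟨u, hu, hu1, hu2⟩ : ∃ u ∈ Set.Icc (natParam ν (θ x)) (natParam ν (θ I)),
          natKL ν (natParam ν (θ I)) u ≤ natKL ν (natParam ν (θ I)) (natParam ν (ϑ I)) ∧
          natKL ν (natParam ν (θ x)) u ≤ natKL ν (natParam ν (θ x)) (natParam ν (ϑ x)) := by
        rcases le_total (natParam ν (ϑ I)) (natParam ν (θ x)) with h1 | h1
        · refine ⟨_, Set.left_mem_Icc.2 hηlt.le, natKL_anti (hη I) (hη x) hI h1 hηlt.le, ?_⟩
          rw [natKL_self (hη x)]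
          exact natKL_nonneg _ _ _
        · rcases le_total (natParam ν (ϑ I)) (natParam ν (θ I)) with h2 | h2
          · exact ⟨_, ⟨h1, h2⟩, le_rfl, natKL_mono (hη x) hI hx h1 hord.le⟩
          · refine ⟨_, Set.right_mem_Icc.2 hηlt.le, ?_,
              natKL_mono (hη x) (hη I) hx hηlt.le (h2.trans hord.le)⟩
            rw [natKL_self (hη I)]
            exact natKL_nonneg _ _ _
      refine ⟨_, ⟨u, hu, rfl⟩, ?_⟩
      rw [information_expModel]
      refine Finset.sum_le_sum fun i _ => mul_le_mul_of_nonneg_left ?_ (hp i)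
      unfold tieKL
      split_ifs with hi
      · rcases hi with rfl | rfl
        · exact hu1
        · exact hu2
      · exact natKL_nonneg _ _ _
    · rintro _ ⟨u, hu, rfl⟩ ε hε
      have huN := hsub hu
      have hopen : natSpace ν ∈ 𝓝 u := isOpen_interior.mem_nhds huN
      have hcont : Tendsto (fun t => p I * natKL ν (natParam ν (θ I)) u +
          p x * natKL ν (natParam ν (θ x)) t) (𝓝[>] u)
          (𝓝 (p I * natKL ν (natParam ν (θ I)) u + p x * natKL ν (natParam ν (θ x)) u)) :=
        ((((continuousOn_natKL (hη x)).continuousAt hopen).tendsto.mono_left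
          nhdsWithin_le_nhds).const_mul _).const_add _
      -- Raising arm `x` slightly above the tie enters the open scenario at cost below `ε`; the arms
      -- other than `I` and `x` keep their true parameters and cost nothing.
      obtain ⟨t, ⟨htε, htN⟩, htu⟩ := (((hcont.eventually_lt_const
        (lt_add_of_pos_right _ hε)).and (nhdsWithin_le_nhds hopen)).and
          self_mem_nhdsWithin).exists
      have htu' : u < t := htu
      set e : Fin K → ℝ := fun i => if i = I then u else if i = x then t
        else natParam ν (θ i) with he
      have heN : ∀ i, e i ∈ natSpace ν := by
        intro i
        simp only [he]
        split_ifs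
        exacts [huN, htN, hη i]
      have heI : e I = u := by simp [he]
      have hex : e x = t := by simp [he, hxI]
      refine ⟨_, ⟨fun i => natMean ν (e i), ⟨fun i => ⟨e i, heN i, rfl⟩, ?_⟩, rfl⟩, ?_⟩
      · rw [armMean_expModel ⟨e I, heN I, rfl⟩, armMean_expModel ⟨e x, heN x, rfl⟩, heI, hex]
        exact hstrict huN htN htu'
      · simp only [hsum]
        refine le_trans (le_of_eq ?_) htε.le
        rw [information_expModel, ← Finset.sum_subset (Finset.subset_univ {I, x}),
          Finset.sum_pair hxI.symm]
        · rw [hinv (heN I), hinv (heN x), heI, hex]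
        · intro i _ hi
          have hi' : i ≠ I ∧ i ≠ x := by simpa using hi
          rw [hinv (heN i)]
          simp only [he, if_neg hi'.1, if_neg hi'.2]
          rw [natKL_self (hη i), mul_zero]

end ExponentialFamily

/-! ### Gaussian linear bandits. -/

section Gaussian

open InformationTheory

lemma gaussianReal_eq_tilted (m m' : ℝ) {v : ℝ≥0} (hv : v ≠ 0) :
    gaussianReal m' v = (gaussianReal m v).tilted fun y => (m' - m) / v * y := by
  have hv' : (v : ℝ) ≠ 0 := by exact_mod_cast hv
  have hmgf : ∫ y, Real.exp ((m' - m) / v * y) ∂gaussianReal m v =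
      Real.exp (m * ((m' - m) / v) + v * ((m' - m) / v) ^ 2 / 2) :=
    congrFun (mgf_id_gaussianReal (μ := m) (v := v)) ((m' - m) / v)
  rw [Measure.tilted, hmgf, gaussianReal_of_var_ne_zero m hv, gaussianReal_of_var_ne_zero m' hv,
    ← withDensity_mul _ (measurable_gaussianPDF m v) (by fun_prop)]
  congr 1
  ext y
  rw [Pi.mul_apply, gaussianPDF, gaussianPDF, ← ENNReal.ofReal_mul (gaussianPDFReal_nonneg _ _ _)]
  congr 1
  rw [gaussianPDFReal, gaussianPDFReal, ← Real.exp_sub,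
    mul_assoc _ (Real.exp _) (Real.exp _), ← Real.exp_add]
  congr 2
  field_simp
  ring

lemma toReal_klDiv_gaussianReal (m m' : ℝ) {v : ℝ≥0} (hv : v ≠ 0) :
    (klDiv (gaussianReal m v) (gaussianReal m' v)).toReal = (m' - m) ^ 2 / (2 * v) := by
  have hv' : (v : ℝ) ≠ 0 := by exact_mod_cast hv
  have hmgf : ∫ y, Real.exp ((m' - m) / v * y) ∂gaussianReal m v =
      Real.exp (m * ((m' - m) / v) + v * ((m' - m) / v) ^ 2 / 2) :=
    congrFun (mgf_id_gaussianReal (μ := m) (v := v)) ((m' - m) / v)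
  rw [gaussianReal_eq_tilted m m' hv, (toReal_klDiv_tilted
    (memLp_one_iff_integrable.1 (memLp_id_gaussianReal 1)) (integrable_exp_mul_gaussianReal _)).2,
    hmgf, Real.log_exp, integral_id_gaussianReal]
  field_simp
  ring

lemma isCompact_affine_inter_box {ι : Type*} [Fintype ι] (W : Submodule ℝ (ι → ℝ)) (y₀ r : ι → ℝ) :
    IsCompact {y : ι → ℝ | y - y₀ ∈ W ∧ ∀ i, |y i| ≤ r i} := by
  have h1 : IsCompact (Set.pi Set.univ fun i => Set.Icc (-r i) (r i)) :=
    isCompact_univ_pi fun i => isCompact_Icc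
  have h2 : IsClosed ((fun y => y - y₀) ⁻¹' (W : Set (ι → ℝ))) :=
    W.closed_of_finiteDimensional.preimage (continuous_id.sub continuous_const)
  convert h1.inter_left h2 using 1
  ext y
  constructor
  · rintro ⟨h, h'⟩
    exact ⟨h, fun i _ => abs_le.1 (h' i)⟩
  · rintro ⟨h, h'⟩
    exact ⟨h, fun i => abs_le.2 (h' i (Set.mem_univ i))⟩

/-- In an affine subspace, every vector is dominated coordinatewise by a vector from a fixed
bounded set. -/
lemma exists_bounded_dominated {ι : Type*} [Fintype ι] (W : Submodule ℝ (ι → ℝ)) (y₀ : ι → ℝ) :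
    ∃ R : ℝ, ∀ y, y - y₀ ∈ W → ∃ y', y' - y₀ ∈ W ∧ (∀ i, |y' i| ≤ |y i|) ∧ ∀ i, |y' i| ≤ R := by
  by_contra! hcon
  have hWc : IsClosed (W : Set (ι → ℝ)) := W.closed_of_finiteDimensional
  -- Among the vectors dominated by a counterexample to the bound `n`, one of least Euclidean norm
  -- is again larger than `n`.
  have hmin : ∀ n : ℕ, ∃ z, z - y₀ ∈ W ∧ (n : ℝ) < ‖z‖ ∧
      ∀ y', y' - y₀ ∈ W → (∀ i, |y' i| ≤ |z i|) → ∑ i, z i ^ 2 ≤ ∑ i, y' i ^ 2 := by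
    intro n
    obtain ⟨y, hy, hbad⟩ := hcon n
    have hcomp := isCompact_affine_inter_box W y₀ fun i => |y i|
    obtain ⟨z, ⟨hzW, hzy⟩, hzmin⟩ := hcomp.exists_isMinOn ⟨y, hy, fun i => le_rfl⟩
      (by fun_prop : Continuous fun z : ι → ℝ => ∑ i, z i ^ 2).continuousOn
    refine ⟨z, hzW, ?_, fun y' hy' hle => hzmin ⟨hy', fun i => (hle i).trans (hzy i)⟩⟩
    obtain ⟨i, hi⟩ := hbad z hzW hzy
    exact hi.trans_le (norm_le_pi_norm z i)
  choose z hzW hzn hzmin using hmin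
  have hpos : ∀ n, 0 < ‖z n‖ := fun n => (Nat.cast_nonneg n).trans_lt (hzn n)
  -- A limit direction of the unbounded minimal vectors lies in `W`, since the offset `y₀` is
  -- negligible after normalization.
  obtain ⟨w, hw, σ, hσ, hlim⟩ := (isCompact_sphere (0 : ι → ℝ) 1).tendsto_subseq
    (x := fun n => ‖z n‖⁻¹ • z n) fun n => by
      rw [mem_sphere_zero_iff_norm, norm_smul, norm_inv, norm_norm, inv_mul_cancel₀ (hpos n).ne']
  have hninf : Tendsto (fun n => ‖z (σ n)‖) atTop atTop :=
    (tendsto_atTop_mono (fun n => (hzn n).le) tendsto_natCast_atTop_atTop).comp hσ.tendsto_atTop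
  have hwW : w ∈ W := by
    have h1 : Tendsto (fun n => ‖z (σ n)‖⁻¹ • z (σ n) - ‖z (σ n)‖⁻¹ • y₀) atTop
        (𝓝 (w - (0 : ℝ) • y₀)) := hlim.sub (hninf.inv_tendsto_atTop.smul_const y₀)
    rw [zero_smul, sub_zero] at h1
    refine hWc.mem_of_tendsto h1 (Eventually.of_forall fun n => ?_)
    rw [← smul_sub]
    exact W.smul_mem _ (hzW _)
  -- Where `w i ≠ 0`, eventually `z i` has the sign of `w i` and more than half its size, so
  -- subtracting `w` shrinks that coordinate. Then `z - w` contradicts minimality.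
  have hev : ∀ i, ∀ᶠ n in atTop, w i ≠ 0 → w i ^ 2 < 2 * (z (σ n) i * w i) := by
    intro i
    by_cases hi : w i = 0
    · exact Eventually.of_forall fun n h => absurd hi h
    · have h1 : Tendsto (fun n => (‖z (σ n)‖⁻¹ • z (σ n)) i * w i) atTop (𝓝 (w i * w i)) :=
        ((tendsto_pi_nhds.1 hlim) i).mul_const _
      have hww : 0 < w i * w i := mul_self_pos.2 hi
      filter_upwards [h1.eventually_const_lt (half_lt_self hww), hninf.eventually_gt_atTop 1]
        with n hn1 hn2 _
      simp only [Pi.smul_apply, smul_eq_mul] at hn1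
      rw [mul_assoc, inv_mul_eq_div, lt_div_iff₀ (hpos _)] at hn1
      nlinarith
  obtain ⟨n, hn⟩ := (eventually_all.2 hev).exists
  have hsq : ∀ i, (z (σ n) i - w i) ^ 2 ≤ z (σ n) i ^ 2 := by
    intro i
    by_cases hi : w i = 0
    · simp [hi]
    · nlinarith [hn i hi]
  have hle := hzmin (σ n) (z (σ n) - w)
    (by rw [sub_right_comm]; exact W.sub_mem (hzW _) hwW)
    (fun i => by rw [← sq_le_sq]; exact hsq i)
  obtain ⟨i, hi⟩ : ∃ i, w i ≠ 0 := by
    by_contra! h0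
    have : w = 0 := funext h0
    rw [this] at hw
    simp at hw
  have hlt : ∑ i, (z (σ n) - w) i ^ 2 < ∑ i, z (σ n) i ^ 2 := by
    refine Finset.sum_lt_sum (fun j _ => hsq j) ⟨i, Finset.mem_univ i, ?_⟩
    have := hn i hi
    simp only [Pi.sub_apply]
    nlinarith
  linarith

variable {K d : ℕ} {A : Matrix (Fin K) (Fin d) ℝ} {v : Fin K → ℝ≥0}

lemma armMean_linModel (ϑ : Fin d → ℝ) (i : Fin K) : armMean (linModel A v) ϑ i = A i ⬝ᵥ ϑ :=
  integral_id_gaussianReal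

lemma information_linModel (hv : ∀ i, v i ≠ 0) (θ ϑ : Fin d → ℝ) (p : Fin K → ℝ) :
    information (linModel A v) θ p ϑ = ∑ i, p i * ((A *ᵥ (ϑ - θ)) i ^ 2 / (2 * v i)) := by
  refine Finset.sum_congr rfl fun i _ => ?_
  rw [linModel, linModel, toReal_klDiv_gaussianReal _ _ (hv i), Matrix.mulVec, dotProduct_sub]

/-- The scenarios of the Gaussian linear bandit. -/
theorem exists_isScenario_linModel (hv : ∀ i, v i ≠ 0) {θ : Fin d → ℝ} {I x : Fin K}
    (hlt : A x ⬝ᵥ θ < A I ⬝ᵥ θ) : ∃ U : Set (Fin K → ℝ),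
      IsScenario U (fun i u => u i ^ 2 / (2 * v i))
        (fun p => scenarioPayoff (linModel A v) Set.univ θ I p x) := by
  have hvpos : ∀ i, (0 : ℝ) < v i := fun i => NNReal.coe_pos.2 (pos_iff_ne_zero.2 (hv i))
  set z : Fin d → ℝ := A x - A I with hz
  -- In the coordinates `y = A (ϑ - θ)` the scenario boundary `z ⬝ᵥ ϑ = 0` is the affine subspace
  -- `y₀ + W`, with base point given by `ϑ = 0`.
  set W : Submodule ℝ (Fin K → ℝ) :=
    (LinearMap.ker (dotProductBilin ℝ ℝ z)).map A.mulVecLin with hW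
  have hmemW : ∀ y, y ∈ W ↔ ∃ k, z ⬝ᵥ k = 0 ∧ A *ᵥ k = y := by
    intro y
    simp [hW, Submodule.mem_map]
  set y₀ : Fin K → ℝ := A *ᵥ (-θ) with hy₀
  obtain ⟨R, hR⟩ := exists_bounded_dominated W y₀
  have hΔ : 0 < z ⬝ᵥ (-θ) := by
    rw [hz, dotProduct_neg, sub_dotProduct]; linarith
  -- Coercivity fails when `p` has zero coordinates; coordinatewise domination supplies one bounded
  -- set that works for all `p ≥ 0`.
  refine ⟨{y | y - y₀ ∈ W ∧ ∀ i, |y i| ≤ R}, ?_, ?_, fun i => ?_, fun i u _ => by positivity,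
    ?_, fun i u _ u' _ => ?_, fun i u _ u' _ hne => ?_, fun p hp => ?_⟩
  · exact isCompact_affine_inter_box W y₀ fun _ => R
  · obtain ⟨y', h1, -, h3⟩ := hR y₀ (by simp)
    exact ⟨y', h1, h3⟩
  · exact (by fun_prop : Continuous fun u : Fin K → ℝ => u i ^ 2 / (2 * (v i : ℝ))).continuousOn
  · rintro u ⟨hu, huR⟩ u' ⟨hu', huR'⟩
    refine ⟨?_, fun i => ?_⟩
    · have e : (1 / 2 : ℝ) • (u + u') - y₀ = (1 / 2 : ℝ) • ((u - y₀) + (u' - y₀)) := by module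
      rw [e]
      exact W.smul_mem _ (W.add_mem hu hu')
    · simp only [Pi.smul_apply, Pi.add_apply, smul_eq_mul]
      rw [abs_le]
      have h1 := abs_le.1 (huR i)
      have h2 := abs_le.1 (huR' i)
      constructor <;> linarith
  · simp only [Pi.smul_apply, Pi.add_apply, smul_eq_mul]
    rw [← add_div, div_div, div_le_div_iff₀ (by have := hvpos i; positivity)
      (by have := hvpos i; positivity)]
    nlinarith [mul_nonneg (hvpos i).le (sq_nonneg (u i - u' i))]
  · have hne' : u i ≠ u' i := fun h => hne (by rw [h])
    simp only [Pi.smul_apply, Pi.add_apply, smul_eq_mul]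
    rw [← add_div, div_div, div_lt_div_iff₀ (by have := hvpos i; positivity)
      (by have := hvpos i; positivity)]
    nlinarith [mul_pos (hvpos i) (sq_pos_of_ne_zero (sub_ne_zero.2 hne'))]
  · have hmono : ∀ y y' : Fin K → ℝ, (∀ i, |y' i| ≤ |y i|) →
        ∑ i, p i * (y' i ^ 2 / (2 * v i)) ≤ ∑ i, p i * (y i ^ 2 / (2 * v i)) := by
      intro y y' hle
      refine Finset.sum_le_sum fun i _ => mul_le_mul_of_nonneg_left ?_ (hp i)
      exact div_le_div_of_nonneg_right (sq_le_sq.2 (hle i)) (by positivity)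
    refine sInf_eq_of_approx ?_ ?_ ?_ ?_ ?_
    · obtain ⟨y', h1, -, h3⟩ := hR y₀ (by simp)
      exact ⟨_, y', ⟨h1, h3⟩, rfl⟩
    · rintro _ ⟨ϑ, -, rfl⟩
      exact information_nonneg _ _ _ hp
    · rintro _ ⟨u, -, rfl⟩
      exact Finset.sum_nonneg fun i _ => mul_nonneg (hp i) (by positivity)
    · rintro _ ⟨ϑ, ⟨-, hϑ⟩, rfl⟩
      rw [armMean_linModel, armMean_linModel] at hϑ
      have hzh : z ⬝ᵥ (-θ) < z ⬝ᵥ (ϑ - θ) := by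
        rw [sub_eq_add_neg, dotProduct_add, hz, sub_dotProduct (A x) (A I) ϑ]
        linarith
      -- The segment from `θ` to the alternative `ϑ` meets the boundary at fraction `c ≤ 1`, where
      -- every divergence is smaller by the factor `c ^ 2`.
      set c := z ⬝ᵥ (-θ) / z ⬝ᵥ (ϑ - θ) with hc
      have hc0 : 0 ≤ c := (div_pos hΔ (hΔ.trans hzh)).le
      have hc1 : c ≤ 1 := (div_le_one (hΔ.trans hzh)).2 hzh.le
      obtain ⟨y', h1, h2, h3⟩ := hR (c • A *ᵥ (ϑ - θ)) (by
        rw [hmemW]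
        refine ⟨c • (ϑ - θ) - (-θ), ?_, ?_⟩
        · rw [dotProduct_sub, dotProduct_smul, smul_eq_mul, hc,
            div_mul_cancel₀ _ (hΔ.trans hzh).ne', sub_self]
        · rw [Matrix.mulVec_sub, Matrix.mulVec_smul])
      refine ⟨_, ⟨y', ⟨h1, h3⟩, rfl⟩, ?_⟩
      rw [information_linModel hv]
      refine hmono _ _ fun i => (h2 i).trans ?_
      rw [Pi.smul_apply, smul_eq_mul, abs_mul, abs_of_nonneg hc0]
      exact mul_le_of_le_one_left (abs_nonneg _) hc1
    · rintro _ ⟨y, ⟨hyW, -⟩, rfl⟩ ε hε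
      obtain ⟨k, hk0, hk⟩ := (hmemW _).1 hyW
      have hy : A *ᵥ (-θ + k) = y := by rw [Matrix.mulVec_add, hk]; abel
      -- Stretching a boundary displacement by `1 + s` enters the open scenario, at a cost that
      -- tends to the boundary cost.
      have hlim : Tendsto (fun s : ℝ => ∑ i, p i * (((1 + s) • y) i ^ 2 / (2 * v i))) (𝓝[>] 0)
          (𝓝 (∑ i, p i * (((1 + (0 : ℝ)) • y) i ^ 2 / (2 * v i)))) :=
        ((by fun_prop : Continuous fun s : ℝ =>
          ∑ i, p i * (((1 + s) • y) i ^ 2 / (2 * (v i : ℝ)))).tendsto 0).mono_left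
            nhdsWithin_le_nhds
      rw [add_zero, one_smul] at hlim
      obtain ⟨s, hs, hs0⟩ := ((hlim.eventually_lt_const
        (lt_add_of_pos_right _ hε)).and self_mem_nhdsWithin).exists
      have hs0' : 0 < s := hs0
      refine ⟨_, ⟨θ + (1 + s) • (-θ + k), ⟨Set.mem_univ _, ?_⟩, rfl⟩, ?_⟩
      · rw [armMean_linModel, armMean_linModel, ← sub_pos, ← sub_dotProduct]
        change 0 < z ⬝ᵥ _
        have e : z ⬝ᵥ (θ + (1 + s) • (-θ + k)) = s * z ⬝ᵥ (-θ) := by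
          rw [dotProduct_add, dotProduct_smul, dotProduct_add, hk0, dotProduct_neg, smul_eq_mul]
          ring
        rw [e]
        exact mul_pos hs0' hΔ
      · rw [information_linModel hv, add_sub_cancel_left, Matrix.mulVec_smul, hy]
        exact hs.le

end Gaussian

end FWSP

end

/-! ### Assembly of the two models. -/

theorem theorem1 :
    (∀ (K : ℕ) (_ : 2 ≤ K) (ν : Measure ℝ) (θ : Fin K → ℝ) (I : Fin K)
      (_ : θ ∈ FWSP.expParams ν K) (_ : FWSP.IsUniqueBestArm (FWSP.expModel ν K) θ I),
      ∃ Fstar : ℝ,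
        FWSP.IsGameValue (FWSP.payoff (FWSP.expModel ν K) (FWSP.expParams ν K) θ I) Fstar ∧
        ∀ (p : ℕ → Fin K → ℝ) (μ : ℕ → {x : Fin K // x ≠ I} → ℝ),
          FWSP.IsTrajectory (FWSP.payoff (FWSP.expModel ν K) (FWSP.expParams ν K) θ I) p μ →
          Tendsto (fun n => FWSP.payoff (FWSP.expModel ν K) (FWSP.expParams ν K) θ I (p n) (μ n))
            atTop (𝓝 Fstar)) ∧
    (∀ (K : ℕ) (_ : 2 ≤ K) (d : ℕ) (A : Matrix (Fin K) (Fin d) ℝ) (v : Fin K → ℝ≥0)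
      (_ : ∀ i, v i ≠ 0) (θ : Fin d → ℝ) (I : Fin K)
      (_ : FWSP.IsUniqueBestArm (FWSP.linModel A v) θ I),
      ∃ Fstar : ℝ,
        FWSP.IsGameValue (FWSP.payoff (FWSP.linModel A v) Set.univ θ I) Fstar ∧
        ∀ (p : ℕ → Fin K → ℝ) (μ : ℕ → {x : Fin K // x ≠ I} → ℝ),
          FWSP.IsTrajectory (FWSP.payoff (FWSP.linModel A v) Set.univ θ I) p μ →
          Tendsto (fun n => FWSP.payoff (FWSP.linModel A v) Set.univ θ I (p n) (μ n))
            atTop (𝓝 Fstar)) := by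
  have hother : ∀ {K : ℕ}, 2 ≤ K → ∀ I : Fin K, Nonempty {x : Fin K // x ≠ I} := by
    intro K hK I
    have : Nontrivial (Fin K) := Fin.nontrivial_iff_two_le.2 hK
    obtain ⟨x, hx⟩ := exists_ne I
    exact ⟨⟨x, hx⟩⟩
  refine ⟨fun K hK ν θ I hθ hI => ?_, fun K hK d A v hv θ I hI => ?_⟩
  · have := hother hK I
    have : Nonempty (Fin K) := ⟨I⟩
    have hlt : ∀ x, x ≠ I → θ x < θ I := fun x hx => by
      have := hI x hx
      rwa [FWSP.armMean_expModel (hθ x), FWSP.armMean_expModel (hθ I)] at this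
    -- For the zero measure every mean integral is `0`, so no arm could be the unique best one.
    have hν : NeZero ν := by
      refine ⟨fun h0 => ?_⟩
      obtain ⟨x, hx⟩ := ‹Nonempty {x : Fin K // x ≠ I}›
      have h1 : ∀ i, θ i = 0 := fun i => by
        obtain ⟨η, -, h⟩ := hθ i
        rw [← h, FWSP.natMean, FWSP.natDist, h0]
        simp
      have h2 := hlt x hx
      rw [h1, h1] at h2
      exact lt_irrefl _ h2
    exact FWSP.exists_gameValue_and_tendsto fun x : {x : Fin K // x ≠ I} =>
      FWSP.isScenario_expModel hθ (hlt x x.2)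
  · have := hother hK I
    have : Nonempty (Fin K) := ⟨I⟩
    choose U hU using fun x : {x : Fin K // x ≠ I} =>
      FWSP.exists_isScenario_linModel (x := x.1) (I := I) (θ := θ) (A := A) hv (by
        have := hI x x.2
        rwa [FWSP.armMean_linModel, FWSP.armMean_linModel] at this)
    exact FWSP.exists_gameValue_and_tendsto hU
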